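/- Let $X$ be a finite alphabet. A directed labeled graph over $X$ is a directed graph (loops and multiple edges allowed) each of whose edges carries a label in $X$. It is folded if, for every vertex $v$ and every $x\in X$, at most one edge labeled $x$ starts at $v$ and at most one edge labeled $x$ terminates at $v$. An elementary folding is the quotient map that identifies two distinct edges with the same label which both start at, or both terminate at, a common vertex $v$, together with their other endpoints (and identifies nothing else). To fold a graph $\Delta$ means to compute a folded graph $\Gamma$ which is obtained from $\Delta$ by a finite, possibly empty, sequence of elementary foldings, together with the resulting quotient map from the vertices of $\Delta$ to those of $\Gamma$. Let $\log^*(n)$ be the least natural number $k$ such that the $k$-fold iterate of the base $2$ logarithm, applied to $n$, is at most $1$ (so $\log^*(0)=\log^*(1)=0$). Running times are counted on a machine whose objects are named by natural numbers, and whose memory consists of finitely many variables and finitely many unary functions (pointer fields) on objects; assigning a variable a constant or the value of another variable, increasing it by one, evaluating a function or changing its value at one object, and comparing two variables each take one unit of time. A graph is given by its numbers of vertices and edges and the functions assigning to each edge its initial vertex, its terminal vertex and its label, and the folded graph is delivered in the same form. Theorem. For every finite alphabet $X$ there is an algorithm which folds any finite connected (in particular nonempty) directed labeled graph $\Delta$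 over $X$ in time $O(E+(V+E)\log^*(V))$, where $V$ and $E$ are the numbers of vertices and edges of $\Delta$: there is a constant $C$, depending only on $X$, such that the running time is at most $C\cdot\max\{1,\;E+(V+E)\log^*(V)\}$. (The maximum matters only for the graph with one vertex and no edge.) -/

import Mathlib

namespace Stallings

/-! ### Directed labeled graphs, folded graphs, foldings -/

/-- A directed graph (loops and multiple edges allowed) with edges labeled by elements of `X`. -/
structure LGraph (X : Type) where
  Vert : Type
  Edge : Type
  ini : Edge → Vert
  ter : Edge → Vert
  lab : Edge → X

/-- Connected: nonempty, and any two vertices are joined by an undirected edge path. -/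
def LGraph.Connected {X : Type} (G : LGraph X) : Prop :=
  Nonempty G.Vert ∧
    ∀ u v : G.Vert, Relation.EqvGen (fun a b => ∃ e : G.Edge, G.ini e = a ∧ G.ter e = b) u v

/-- Folded: at each vertex there is, for every label, at most one edge with that label starting
there, and at most one edge with that label terminating there. -/
def LGraph.Folded {X : Type} (G : LGraph X) : Prop :=
  (∀ e e' : G.Edge, G.lab e = G.lab e' → G.ini e = G.ini e' → e = e') ∧
    (∀ e e' : G.Edge, G.lab e = G.lab e' → G.ter e = G.ter e' → e = e')

/-- Maps of directed labeled graphs. -/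
structure LGraph.Hom {X : Type} (G H : LGraph X) where
  vert : G.Vert → H.Vert
  edge : G.Edge → H.Edge
  ini_edge : ∀ e, H.ini (edge e) = vert (G.ini e)
  ter_edge : ∀ e, H.ter (edge e) = vert (G.ter e)
  lab_edge : ∀ e, H.lab (edge e) = G.lab e

/-- The identity map. -/
def LGraph.Hom.id {X : Type} (G : LGraph X) : G.Hom G where
  vert v := v
  edge e := e
  ini_edge _ := rfl
  ter_edge _ := rfl
  lab_edge _ := rfl

/-- First `f`, then `g`. -/
def LGraph.Hom.trans {X : Type} {G H K : LGraph X} (f : G.Hom H) (g : H.Hom K) : G.Hom K where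
  vert v := g.vert (f.vert v)
  edge e := g.edge (f.edge e)
  ini_edge e := by rw [g.ini_edge, f.ini_edge]
  ter_edge e := by rw [g.ter_edge, f.ter_edge]
  lab_edge e := by rw [g.lab_edge, f.lab_edge]

/-- `f` is a quotient map that identifies `a` with `b` and nothing else
(if `a = b`, it identifies nothing). -/
def Identifies {α β : Type} (f : α → β) (a b : α) : Prop :=
  Function.Surjective f ∧ ∀ x y, f x = f y ↔ x = y ∨ (x = a ∧ y = b) ∨ (x = b ∧ y = a)

/-- An elementary folding: the quotient map that identifies two distinct edges `e₁`, `e₂` with the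
same label which both start (or both terminate) at a common vertex, together with their other
endpoints. -/
def LGraph.Hom.IsElementaryFolding {X : Type} {G H : LGraph X} (f : G.Hom H) : Prop :=
  ∃ e₁ e₂ : G.Edge, e₁ ≠ e₂ ∧ G.lab e₁ = G.lab e₂ ∧ Identifies f.edge e₁ e₂ ∧
    ((G.ini e₁ = G.ini e₂ ∧ Identifies f.vert (G.ter e₁) (G.ter e₂)) ∨
      (G.ter e₁ = G.ter e₂ ∧ Identifies f.vert (G.ini e₁) (G.ini e₂)))

/-- Compositions of finite (possibly empty) sequences of elementary foldings. -/
inductive IsFolding {X : Type} : {G H : LGraph X} → G.Hom H → Prop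
  | refl (G : LGraph X) : IsFolding (LGraph.Hom.id G)
  | step {G H K : LGraph X} (f : G.Hom H) (g : H.Hom K) :
      f.IsElementaryFolding → IsFolding g → IsFolding (f.trans g)

/-! ### The iterated logarithm -/

/-- `logStar m` is the least `k` such that the `k`-fold iterate of the base 2 logarithm,
applied to `m`, is at most 1. -/
noncomputable def logStar (m : ℕ) : ℕ :=
  sInf {k : ℕ | (Real.logb 2)^[k] (m : ℝ) ≤ 1}

/-! ### Programs and their running time

Objects are named by natural numbers. The memory consists of variables and of unary functions
(pointer fields), each of which sends objects to objects or numbers. Reading or changing a variable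
or a single value of a unary function costs one unit of time, and so does a comparison. The only
arithmetic is the successor, so that a program running for time `t` cannot produce numbers that
exceed both its constants and the numbers in the input by more than `t`. -/

/-- `reg r` is the value of the variable `r`; `fld f x` is the value at `x` of the function `f`. -/
structure Mem where
  reg : ℕ → ℕ
  fld : ℕ → ℕ → ℕ

/-- Comparisons between two variables. -/
inductive Test
  | eq (r s : ℕ)
  | ne (r s : ℕ)
  | lt (r s : ℕ)

/-- The truth value of a comparison. -/
def Test.Holds (m : Mem) : Test → Prop
  | .eq r s => m.reg r = m.reg s
  | .ne r s => m.reg r ≠ m.reg s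
  | .lt r s => m.reg r < m.reg s

/-- Primitive operations. -/
inductive Prim
  /-- do nothing -/
  | skip
  /-- `r := c` -/
  | const (r c : ℕ)
  /-- `r := s` -/
  | copy (r s : ℕ)
  /-- `r := r + 1` -/
  | succ (r : ℕ)
  /-- `r := f(s)` -/
  | load (r f s : ℕ)
  /-- `f(r) := s` -/
  | store (f r s : ℕ)

/-- The effect of a primitive operation. -/
def Prim.run (m : Mem) : Prim → Mem
  | .skip => m
  | .const r c => { m with reg := Function.update m.reg r c }
  | .copy r s => { m with reg := Function.update m.reg r (m.reg s) }
  | .succ r => { m with reg := Function.update m.reg r (m.reg r + 1) }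
  | .load r f s => { m with reg := Function.update m.reg r (m.fld f (m.reg s)) }
  | .store f r s =>
      { m with fld := Function.update m.fld f (Function.update (m.fld f) (m.reg r) (m.reg s)) }

/-- Programs. A program is a finite object, hence it mentions only finitely many variables and
functions. -/
inductive Prog
  | prim (p : Prim)
  | seq (c d : Prog)
  | ite (b : Test) (c d : Prog)
  | loop (b : Test) (c : Prog)

/-- `Exec c m t m'`: started in memory `m`, the program `c` terminates after time exactly `t` in
memory `m'`. Every primitive operation and every evaluation of a test takes one unit of time. -/
inductive Exec : Prog → Mem → ℕ → Mem → Prop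
  | prim (p : Prim) (m : Mem) : Exec (.prim p) m 1 (p.run m)
  | seq {c d : Prog} {m m' m'' : Mem} {t t' : ℕ} :
      Exec c m t m' → Exec d m' t' m'' → Exec (.seq c d) m (t + t') m''
  | ite_true {b : Test} {c d : Prog} {m m' : Mem} {t : ℕ} :
      b.Holds m → Exec c m t m' → Exec (.ite b c d) m (t + 1) m'
  | ite_false {b : Test} {c d : Prog} {m m' : Mem} {t : ℕ} :
      ¬ b.Holds m → Exec d m t m' → Exec (.ite b c d) m (t + 1) m'
  | loop_done {b : Test} {c : Prog} {m : Mem} :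
      ¬ b.Holds m → Exec (.loop b c) m 1 m
  | loop_step {b : Test} {c : Prog} {m m' m'' : Mem} {t t' : ℕ} :
      b.Holds m → Exec c m t m' → Exec (.loop b c) m' t' m'' →
        Exec (.loop b c) m (t + t' + 1) m''

/-! ### Graphs in memory -/

/-- A numbering of the vertices and edges of a (finite) graph by `0, …, numV - 1` and
`0, …, numE - 1`; thus `numV` and `numE` are the numbers of vertices and of edges. -/
structure Numbering {X : Type} (G : LGraph X) where
  numV : ℕ
  numE : ℕ
  vert : G.Vert ≃ Fin numV
  edge : G.Edge ≃ Fin numE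

/-- The memory holds the graph `G`, numbered by `N`: variables 0 and 1 hold the numbers of vertices
and of edges, the functions 0, 1, 2 hold the initial vertex, the terminal vertex and the label of
each edge. Nothing is required of the rest of the memory. -/
def Mem.Encodes {n : ℕ} (m : Mem) (G : LGraph (Fin n)) (N : Numbering G) : Prop :=
  m.reg 0 = N.numV ∧ m.reg 1 = N.numE ∧
    ∀ e : G.Edge, m.fld 0 (N.edge e) = N.vert (G.ini e) ∧
      m.fld 1 (N.edge e) = N.vert (G.ter e) ∧ m.fld 2 (N.edge e) = G.lab e

/-- The function 3 in memory holds the vertex map of `π`. -/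
def Mem.EncodesMap {n : ℕ} (m : Mem) {G H : LGraph (Fin n)} (π : G.Hom H)
    (N : Numbering G) (M : Numbering H) : Prop :=
  ∀ v : G.Vert, m.fld 3 (N.vert v) = M.vert (π.vert v)

end Stallings

/-! The order of the foldings does not matter. Call a function on the vertices fold-closed if, for
any two edges with the same label, it agrees on the initial vertices exactly when it agrees on the
terminal ones. The vertex map of a folding onto a folded graph is fold-closed
(`LGraph.Hom.foldClosed`), and every fold-closed function is constant on its fibres
(`IsFolding.minimal`). So these fibres form the finest fold-closed partition, and the class of an
edge is determined by its label and the class of its initial vertex. A folding can thus be chosen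
abstractly (`LGraph.exists_isFolding`); the program only has to find this partition and list the
edge classes, and need not follow any sequence of elementary foldings.

The partition is kept as a union-find forest. Every edge gives two half-edges, of types `k` and `k +
n`, and each root has a table with at most one target for each of the `2 * n` types. A second target
for an occupied entry is not stored; the two targets become a pair in a queue. To process a pair,
find the two roots, link them by rank if they differ, and enter the child's table into that of the
new root, which may create new pairs. Two invariants (`Tables`) squeeze the result: a pair is queued
only if every compatible `c` must identify its members, and every half-edge is represented up to the
current classes and the pending pairs. When the queue is empty, the root function is itself
compatible, so its fibres are the finest partition.

Entering the edges creates at most `2 * E` pairs, and each of the fewer than `V` links at most `2 *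
n` more, so there are `O(V + E)` finds. A find with path halving costs `O(log* V)` amortized. Ranks
are grouped into levels bounded by towers of twos. A halving step either enters a higher level,
which happens at most `log* V` times in one find, or reaches a root, or increases the total `charge`
(`Forest.charge_lt_charge_halve`). The charge never decreases and is at most `2 * V * (log* V + 1)`
(`Forest.charge_le`), because nodes of high rank are rare. -/

namespace Stallings

/-! ### Existence and minimality of foldings -/

/-- The equivalence relation that identifies `a` with `b` and nothing else. -/
def identifySetoid {α : Type} (a b : α) : Setoid α where
  r x y := x = y ∨ (x = a ∧ y = b) ∨ (x = b ∧ y = a)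
  iseqv := by
    refine ⟨fun x => Or.inl rfl, ?_, ?_⟩
    · grind
    · grind

theorem identifies_mk {α : Type} (a b : α) :
    Identifies (Quotient.mk (identifySetoid a b)) a b :=
  ⟨Quotient.mk_surjective, fun _ _ => Quotient.eq⟩

/-- The quotient of `G` that identifies the edges `e₁`, `e₂` and the vertices `a`, `b`. -/
def LGraph.identify {X : Type} (G : LGraph X) (e₁ e₂ : G.Edge) (a b : G.Vert)
    (hl : G.lab e₁ = G.lab e₂)
    (hi : G.ini e₁ = G.ini e₂ ∨ (G.ini e₁ = a ∧ G.ini e₂ = b))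
    (ht : G.ter e₁ = G.ter e₂ ∨ (G.ter e₁ = a ∧ G.ter e₂ = b)) : LGraph X where
  Vert := Quotient (identifySetoid a b)
  Edge := Quotient (identifySetoid e₁ e₂)
  ini := Quotient.lift (fun e => Quotient.mk (identifySetoid a b) (G.ini e)) (by
    intro x y h
    apply Quotient.sound
    change _ ∨ _
    have h' : x = y ∨ (x = e₁ ∧ y = e₂) ∨ (x = e₂ ∧ y = e₁) := h
    grind)
  ter := Quotient.lift (fun e => Quotient.mk (identifySetoid a b) (G.ter e)) (by
    intro x y h
    apply Quotient.sound
    change _ ∨ _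
    have h' : x = y ∨ (x = e₁ ∧ y = e₂) ∨ (x = e₂ ∧ y = e₁) := h
    grind)
  lab := Quotient.lift G.lab (by
    intro x y h
    have h' : x = y ∨ (x = e₁ ∧ y = e₂) ∨ (x = e₂ ∧ y = e₁) := h
    grind)

theorem LGraph.exists_isElementaryFolding {X : Type} (G : LGraph X) (h : ¬ G.Folded) :
    ∃ (H : LGraph X) (f : G.Hom H), f.IsElementaryFolding := by
  have h' : ∃ e₁ e₂ : G.Edge, e₁ ≠ e₂ ∧ G.lab e₁ = G.lab e₂ ∧
      (G.ini e₁ = G.ini e₂ ∨ G.ter e₁ = G.ter e₂) := by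
    by_contra! hn
    exact h ⟨fun e e' hl hi => by_contra fun hne => (hn e e' hne hl).1 hi,
      fun e e' hl hi => by_contra fun hne => (hn e e' hne hl).2 hi⟩
  obtain ⟨e₁, e₂, hne, hl, hi | ht⟩ := h'
  · exact ⟨G.identify e₁ e₂ (G.ter e₁) (G.ter e₂) hl (Or.inl hi) (Or.inr ⟨rfl, rfl⟩),
      ⟨Quotient.mk _, Quotient.mk _, fun _ => rfl, fun _ => rfl, fun _ => rfl⟩,
      e₁, e₂, hne, hl, identifies_mk _ _, Or.inl ⟨hi, identifies_mk _ _⟩⟩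
  · exact ⟨G.identify e₁ e₂ (G.ini e₁) (G.ini e₂) hl (Or.inr ⟨rfl, rfl⟩) (Or.inl ht),
      ⟨Quotient.mk _, Quotient.mk _, fun _ => rfl, fun _ => rfl, fun _ => rfl⟩,
      e₁, e₂, hne, hl, identifies_mk _ _, Or.inr ⟨ht, identifies_mk _ _⟩⟩

theorem LGraph.Hom.IsElementaryFolding.surjective {X : Type} {G H : LGraph X} {f : G.Hom H}
    (hf : f.IsElementaryFolding) :
    Function.Surjective f.vert ∧ Function.Surjective f.edge := by
  obtain ⟨e₁, e₂, -, -, he, ⟨-, hv⟩ | ⟨-, hv⟩⟩ := hf <;> exact ⟨hv.1, he.1⟩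

theorem LGraph.Hom.IsElementaryFolding.card_lt {X : Type} {G H : LGraph X} {f : G.Hom H}
    (hf : f.IsElementaryFolding) [Finite G.Edge] :
    Finite H.Edge ∧ Nat.card H.Edge < Nat.card G.Edge := by
  have hs := hf.surjective.2
  refine ⟨Finite.of_surjective _ hs, lt_of_le_of_ne (Nat.card_le_card_of_surjective _ hs) ?_⟩
  intro hc
  obtain ⟨e₁, e₂, hne, -, he, -⟩ := hf
  have := (Nat.bijective_iff_surjective_and_card f.edge).2 ⟨hs, hc.symm⟩
  exact hne (this.1 ((he.2 _ _).2 (Or.inr (Or.inl ⟨rfl, rfl⟩))))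

theorem IsFolding.surjective {X : Type} {G H : LGraph X} {f : G.Hom H} (hf : IsFolding f) :
    Function.Surjective f.vert ∧ Function.Surjective f.edge := by
  induction hf with
  | refl G => exact ⟨Function.surjective_id, Function.surjective_id⟩
  | step f g hf _ ih =>
    exact ⟨ih.1.comp hf.surjective.1, ih.2.comp hf.surjective.2⟩

/-- Each elementary folding strictly decreases the number of edges, so folding as long as possible
terminates. -/
theorem LGraph.exists_isFolding {X : Type} (G : LGraph X) [Finite G.Edge] :
    ∃ (H : LGraph X) (f : G.Hom H), IsFolding f ∧ H.Folded := by
  induction hk : Nat.card G.Edge using Nat.strong_induction_on generalizing G with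
  | _ k ih =>
    by_cases h : G.Folded
    · exact ⟨G, _, IsFolding.refl G, h⟩
    · obtain ⟨H, f, hf⟩ := G.exists_isElementaryFolding h
      obtain ⟨hfin, hlt⟩ := hf.card_lt
      obtain ⟨K, g, hg, hK⟩ := ih _ (hk ▸ hlt) H rfl
      exact ⟨K, _, IsFolding.step f g hf hg, hK⟩

/-- A function on the vertices whose fibres are compatible with folding. -/
def LGraph.FoldClosed {X α : Type} (G : LGraph X) (c : G.Vert → α) : Prop :=
  ∀ e e' : G.Edge, G.lab e = G.lab e' →
    (c (G.ini e) = c (G.ini e') ↔ c (G.ter e) = c (G.ter e'))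

theorem LGraph.Hom.foldClosed {X : Type} {G H : LGraph X} (f : G.Hom H) (hH : H.Folded) :
    G.FoldClosed f.vert := by
  intro e e' hl
  have hl' : H.lab (f.edge e) = H.lab (f.edge e') := by rw [f.lab_edge, f.lab_edge, hl]
  rw [← f.ini_edge, ← f.ini_edge, ← f.ter_edge, ← f.ter_edge]
  exact ⟨fun h => by rw [hH.1 _ _ hl' h], fun h => by rw [hH.2 _ _ hl' h]⟩

/-- The two folded edges have the same label and share one endpoint, so a fold-closed `c` already
agrees on their other endpoints. Being fold-closed then passes to the quotient, since edges and
vertices of `H` lift to `G`. -/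
theorem LGraph.Hom.IsElementaryFolding.factor {X α : Type} {G H : LGraph X} {f : G.Hom H}
    (hf : f.IsElementaryFolding) {c : G.Vert → α} (hc : G.FoldClosed c) :
    ∃ d : H.Vert → α, (∀ v, d (f.vert v) = c v) ∧ H.FoldClosed d := by
  have hs := hf.surjective
  have key : ∀ x y, f.vert x = f.vert y → c x = c y := by
    obtain ⟨e₁, e₂, hne, hl, he, ⟨hi, hv⟩ | ⟨hi, hv⟩⟩ := hf
    · have := (hc e₁ e₂ hl).1 (congrArg c hi)
      intro x y hxy
      rcases (hv.2 x y).1 hxy with h | ⟨h, h'⟩ | ⟨h, h'⟩ <;> simp [*]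
    · have := (hc e₁ e₂ hl).2 (congrArg c hi)
      intro x y hxy
      rcases (hv.2 x y).1 hxy with h | ⟨h, h'⟩ | ⟨h, h'⟩ <;> simp [*]
  have hd : ∀ v, c (Function.surjInv hs.1 (f.vert v)) = c v :=
    fun v => key _ _ (Function.surjInv_eq hs.1 _)
  refine ⟨fun w => c (Function.surjInv hs.1 w), hd, ?_⟩
  intro e e' hl
  obtain ⟨e, rfl⟩ := hs.2 e
  obtain ⟨e', rfl⟩ := hs.2 e'
  rw [f.lab_edge, f.lab_edge] at hl
  simp only [f.ini_edge, f.ter_edge, hd]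
  exact hc e e' hl

theorem IsFolding.minimal {X α : Type} {G H : LGraph X} {f : G.Hom H} (hf : IsFolding f)
    {c : G.Vert → α} (hc : G.FoldClosed c) {u v : G.Vert} (h : f.vert u = f.vert v) :
    c u = c v := by
  induction hf with
  | refl G => exact congrArg c h
  | step f g hf _ ih =>
    obtain ⟨d, hd, hdc⟩ := hf.factor hc
    rw [← hd, ← hd]
    exact ih hdc h

/-- Used for vertices and for edges: the abstract folded graph and the program's output are both
quotients of the input, so equal kernels turn the output into a numbering of the abstract graph. -/
theorem exists_equiv_of_kernel_eq {α β γ : Type} {p : α → β} {q : α → γ}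
    (hp : Function.Surjective p) (hq : Function.Surjective q)
    (h : ∀ x y, p x = p y ↔ q x = q y) : ∃ φ : β ≃ γ, ∀ x, φ (p x) = q x := by
  have key : ∀ x, q (Function.surjInv hp (p x)) = q x :=
    fun x => (h _ _).1 (Function.surjInv_eq hp _)
  refine ⟨Equiv.ofBijective (fun b => q (Function.surjInv hp b)) ⟨?_, ?_⟩, key⟩
  · intro b b' hb
    have := (h _ _).2 hb
    rwa [Function.surjInv_eq hp, Function.surjInv_eq hp] at this
  · intro y
    obtain ⟨x, rfl⟩ := hq y
    exact ⟨p x, key x⟩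

/-! ### Towers of exponentials and the iterated logarithm -/

/-- The tower of `i` twos. -/
def tower : ℕ → ℕ
  | 0 => 1
  | i + 1 => 2 ^ tower i

theorem tower_lt_succ (i : ℕ) : tower i < tower (i + 1) := Nat.lt_two_pow_self

theorem tower_strictMono : StrictMono tower := strictMono_nat_of_lt_succ tower_lt_succ

theorem lt_tower (i : ℕ) : i < tower i := by
  induction i with
  | zero => simp [tower]
  | succ i ih => have := tower_lt_succ i; omega

theorem exists_lt_tower (r : ℕ) : ∃ i, r < tower i := ⟨r, lt_tower r⟩

/-- The least `i` such that `r` is below the tower of `i` twos. -/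
def level (r : ℕ) : ℕ := Nat.find (exists_lt_tower r)

theorem lt_tower_level (r : ℕ) : r < tower (level r) := Nat.find_spec (exists_lt_tower r)

theorem level_le_of_lt_tower {r i : ℕ} (h : r < tower i) : level r ≤ i := Nat.find_min' _ h

theorem level_mono {r s : ℕ} (h : r ≤ s) : level r ≤ level s :=
  level_le_of_lt_tower (h.trans_lt (lt_tower_level s))

theorem level_lt_of_tower_le {r s : ℕ} (h : tower (level r) ≤ s) : level r < level s := by
  by_contra! hs
  have := tower_strictMono.monotone hs
  have := lt_tower_level s
  omega

theorem le_tower_of_iterate_logb_le (k : ℕ) (x : ℝ) (h : (Real.logb 2)^[k] x ≤ 1) :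
    x ≤ tower k := by
  induction k generalizing x with
  | zero => simpa [tower] using h
  | succ k ih =>
    rw [Function.iterate_succ_apply] at h
    have h1 := ih _ h
    -- For `x ≤ 0` the value of `Real.logb` carries no information, but the bound is trivial.
    rcases le_or_gt x 0 with hx | hx
    · exact hx.trans (Nat.cast_nonneg _)
    · rw [Real.logb_le_iff_le_rpow (by norm_num) hx] at h1
      simpa [tower] using h1

theorem tower_lt_of_iterate_logb_gt (k : ℕ) (x : ℝ) (h : ∀ j ≤ k, 1 < (Real.logb 2)^[j] x) :
    (tower k : ℝ) < x := by
  induction k generalizing x with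
  | zero => simpa [tower] using h 0 le_rfl
  | succ k ih =>
    have hx : 1 < x := h 0 (Nat.zero_le _)
    have h1 := ih (Real.logb 2 x) fun j hj => by
      have := h (j + 1) (by omega)
      rwa [Function.iterate_succ_apply] at this
    rw [Real.lt_logb_iff_rpow_lt (by norm_num) (by linarith)] at h1
    simpa [tower] using h1

theorem le_tower_logStar (m : ℕ) : m ≤ tower (logStar m) := by
  have hne : {k : ℕ | (Real.logb 2)^[k] (m : ℝ) ≤ 1}.Nonempty := by
    by_contra! hn
    have := tower_lt_of_iterate_logb_gt m m fun j _ => by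
      have : j ∉ {k : ℕ | (Real.logb 2)^[k] (m : ℝ) ≤ 1} := by rw [hn]; simp
      simpa using this
    have h2 := lt_tower m
    have h3 : tower m < m := by exact_mod_cast this
    omega
  have := le_tower_of_iterate_logb_le _ _ (Nat.sInf_mem hne)
  exact_mod_cast this

theorem logStar_pos {m : ℕ} (h : 2 ≤ m) : 1 ≤ logStar m := by
  by_contra! h0
  have := le_tower_logStar m
  rw [Nat.lt_one_iff.1 h0] at this
  simp only [tower] at this
  omega

/-- A rank `r` occurs only in a forest with at least `2 ^ r` nodes, so this bounds the number of
levels that a find can cross. -/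
theorem level_le_logStar {r m : ℕ} (h : 2 ^ r ≤ m) : level r ≤ logStar m :=
  level_le_of_lt_tower (Nat.lt_two_pow_self.trans_le (h.trans (le_tower_logStar m)))

/-- An increasing function of the rank: the weighted number of ranks up to `r`, where the rank `j`
has weight `tower (level j) / 2 ^ j`. -/
def rankWeight (r : ℕ) : ℚ := 2 * (level r + 1) - tower (level r) / 2 ^ r

theorem level_succ (r : ℕ) :
    level (r + 1) = level r ∨ (level (r + 1) = level r + 1 ∧ tower (level r) = r + 1) := by
  rcases Nat.lt_or_ge (r + 1) (tower (level r)) with h | h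
  · exact Or.inl (le_antisymm (level_le_of_lt_tower h) (level_mono (Nat.le_succ r)))
  · right
    have h1 := lt_tower_level r
    have h2 := level_lt_of_tower_le h
    have h3 : tower (level r) = r + 1 := by omega
    refine ⟨le_antisymm (level_le_of_lt_tower ?_) h2, h3⟩
    have := tower_lt_succ (level r)
    omega

/-- Within a level the closed form is a partial geometric sum and grows by exactly the weight of the
new rank. A new level begins at a rank `r + 1` that is itself a tower, whose weight is `1`; there
the claim holds with `tower (level r) / 2 ^ r` to spare. Each level contributes at most `2` in all,
whence the bound linear in the level. -/
theorem rankWeight_succ (r : ℕ) :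
    rankWeight r + tower (level (r + 1)) / 2 ^ (r + 1) ≤ rankWeight (r + 1) := by
  unfold rankWeight
  rcases level_succ r with h | ⟨h, h'⟩
  · rw [h, pow_succ]
    have : (tower (level r) : ℚ) / 2 ^ r = 2 * (tower (level r) / (2 ^ r * 2)) := by
      field_simp
    linarith
  · have h1 : (tower (level (r + 1)) : ℚ) = 2 ^ (r + 1) := by rw [h, tower, h']; push_cast; rfl
    rw [h1, div_self (by positivity), h]
    have : (0 : ℚ) ≤ tower (level r) / 2 ^ r := by positivity
    push_cast
    linarith

theorem rankWeight_mono : Monotone rankWeight := monotone_nat_of_le_succ fun r => by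
  have := rankWeight_succ r
  have h : (0 : ℚ) ≤ tower (level (r + 1)) / 2 ^ (r + 1) := by positivity
  linarith

theorem level_zero : level 0 = 0 := Nat.le_zero.1 (level_le_of_lt_tower (by simp [tower]))

theorem rankWeight_zero : rankWeight 0 = 1 := by
  norm_num [rankWeight, level_zero, tower]

theorem rankWeight_le (r : ℕ) : rankWeight r ≤ 2 * (level r + 1) := by
  unfold rankWeight
  have : (0 : ℚ) ≤ tower (level r) / 2 ^ r := by positivity
  linarith
section Forest

open Finset

/-! ### Union-find forests with ranks -/

/-- `par` and `rk` are the parent pointers and the ranks of a forest on `0, …, V - 1` whose roots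
are the fixed points of `par`; `rt` sends each node to the root of its tree, and `sz` records the
sizes of the trees at their roots. -/
structure Forest (V : ℕ) (par rk rt sz : ℕ → ℕ) : Prop where
  par_lt : ∀ x < V, par x < V
  rk_lt : ∀ x < V, par x ≠ x → rk x < rk (par x)
  rt_par : ∀ x < V, rt (par x) = rt x
  rt_self : ∀ x < V, par x = x → rt x = x
  par_rt : ∀ x < V, par (rt x) = rt x
  rt_lt : ∀ x < V, rt x < V
  le_sz : ∀ x < V, par x = x → 2 ^ rk x ≤ sz x
  sum_sz : ∑ x ∈ range V, sz x = V
  pow_le : ∀ x < V, 2 ^ rk x ≤ V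
  weight : ∑ x ∈ range V, (tower (level (rk x)) : ℚ) ≤ ∑ x ∈ range V, sz x * rankWeight (rk x)

/-- The charges accumulated by the nodes of a forest. -/
def charge (V : ℕ) (par rk : ℕ → ℕ) : ℕ :=
  ∑ x ∈ range V, if par x = x then 0 else min (rk (par x)) (tower (level (rk x)))

/-- The number of trees of a forest. -/
def numRoots (V : ℕ) (par : ℕ → ℕ) : ℕ := #{x ∈ range V | par x = x}

theorem numRoots_le (V : ℕ) (par : ℕ → ℕ) : numRoots V par ≤ V :=
  (card_filter_le _ _).trans (card_range V).le

theorem sum_of_eq_off_pair {M : Type*} [AddCommMonoid M] {s : Finset ℕ} {f g : ℕ → M} {u w : ℕ}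
    (hu : u ∈ s) (hw : w ∈ s) (huw : u ≠ w) (h : ∀ x ∈ s, x ≠ u → x ≠ w → f x = g x) :
    ∃ r, ∑ x ∈ s, f x = f u + f w + r ∧ ∑ x ∈ s, g x = g u + g w + r := by
  have hw' : w ∈ s.erase u := mem_erase.2 ⟨huw.symm, hw⟩
  refine ⟨∑ x ∈ (s.erase u).erase w, f x, ?_, ?_⟩
  · rw [← add_sum_erase s f hu, ← add_sum_erase _ f hw', add_assoc]
  · rw [← add_sum_erase s g hu, ← add_sum_erase _ g hw', add_assoc]
    congr 2
    refine sum_congr rfl fun x hx => ?_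
    simp only [mem_erase] at hx
    exact (h x hx.2.2 hx.2.1 hx.1).symm

namespace Forest

variable {V : ℕ} {par rk rt sz : ℕ → ℕ}

theorem of_singletons (hp : ∀ x < V, par x = x) (hr : ∀ x < V, rk x = 0) :
    Forest V par rk (fun x => x) (fun _ => 1) where
  par_lt x hx := by rwa [hp x hx]
  rk_lt x hx h := absurd (hp x hx) h
  rt_par x hx := hp x hx
  rt_self _ _ _ := rfl
  par_rt x hx := hp x hx
  rt_lt x hx := hx
  le_sz x hx _ := by simp [hr x hx]
  sum_sz := by simp
  pow_le x hx := by rw [hr x hx]; simp; omega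
  weight := by
    refine sum_le_sum fun x hx => ?_
    rw [hr x (mem_range.1 hx), rankWeight_zero, level_zero]
    simp [tower]

theorem level_le (F : Forest V par rk rt sz) {x : ℕ} (hx : x < V) :
    level (rk x) ≤ logStar V := level_le_logStar (F.pow_le x hx)

theorem rk_lt_card (F : Forest V par rk rt sz) {x : ℕ} (hx : x < V) : rk x < V :=
  Nat.lt_two_pow_self.trans_le (F.pow_le x hx)

theorem rt_rt (F : Forest V par rk rt sz) {x : ℕ} (hx : x < V) : rt (rt x) = rt x :=
  F.rt_self _ (F.rt_lt x hx) (F.par_rt x hx)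

theorem rk_le_par (F : Forest V par rk rt sz) {x : ℕ} (hx : x < V) : rk x ≤ rk (par x) := by
  by_cases h : par x = x
  · rw [h]
  · exact (F.rk_lt x hx h).le

theorem par_eq_of_par_par_eq (F : Forest V par rk rt sz) {x : ℕ} (hx : x < V)
    (h : par (par x) = x) : par x = x := by
  by_contra hne
  have h1 := F.rk_lt x hx hne
  have h2 := F.rk_le_par (F.par_lt x hx)
  rw [h] at h2
  omega

/-- Each node is charged at most the tower of its level. By the field `weight`, these towers are
paid for by the tree sizes, which add up to `V`, at a price of at most `2 * (logStar V + 1)` per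
unit of size. -/
theorem charge_le (F : Forest V par rk rt sz) : charge V par rk ≤ 2 * V * (logStar V + 1) := by
  have h1 : (charge V par rk : ℚ) ≤ ∑ x ∈ range V, (tower (level (rk x)) : ℚ) := by
    unfold charge
    push_cast
    refine sum_le_sum fun x _ => ?_
    split_ifs
    · positivity
    · exact_mod_cast min_le_right _ _
  have h2 : ∑ x ∈ range V, sz x * rankWeight (rk x) ≤
      ∑ x ∈ range V, (sz x : ℚ) * (2 * (logStar V + 1)) := by
    refine sum_le_sum fun x hx => mul_le_mul_of_nonneg_left ?_ (Nat.cast_nonneg _)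
    refine (rankWeight_le _).trans ?_
    have := F.level_le (mem_range.1 hx)
    have h : (level (rk x) : ℚ) ≤ logStar V := by exact_mod_cast this
    linarith
  rw [← sum_mul] at h2
  have h3 : ∑ x ∈ range V, (sz x : ℚ) = V := by exact_mod_cast F.sum_sz
  rw [h3] at h2
  have h4 := (h1.trans F.weight).trans h2
  have h5 : (charge V par rk : ℚ) ≤ ((2 * V * (logStar V + 1) : ℕ) : ℚ) := by
    push_cast
    linarith
  exact_mod_cast h5

/-- Replacing the parent of a node by its grandparent. -/
theorem halve (F : Forest V par rk rt sz) {x : ℕ} (hx : x < V) :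
    Forest V (Function.update par x (par (par x))) rk rt sz := by
  have hp := F.par_lt x hx
  refine ⟨?_, ?_, ?_, ?_, ?_, F.rt_lt, ?_, F.sum_sz, F.pow_le, F.weight⟩
  · intro y hy
    rcases eq_or_ne y x with rfl | h
    · simpa using F.par_lt _ hp
    · simpa [h] using F.par_lt y hy
  · intro y hy
    rcases eq_or_ne y x with rfl | h
    · intro h'
      simp only [Function.update_self] at h' ⊢
      have hne : par y ≠ y := fun e => h' (by rw [e, e])
      exact (F.rk_lt y hy hne).trans_le (F.rk_le_par hp)
    · simpa [h] using F.rk_lt y hy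
  · intro y hy
    rcases eq_or_ne y x with rfl | h
    · simp [F.rt_par _ hp, F.rt_par _ hx]
    · simpa [h] using F.rt_par y hy
  · intro y hy
    rcases eq_or_ne y x with rfl | h
    · intro h'
      simp only [Function.update_self] at h'
      exact F.rt_self y hy (F.par_eq_of_par_par_eq hy h')
    · simpa [h] using F.rt_self y hy
  · intro y hy
    have h1 := F.par_rt y hy
    rcases eq_or_ne (rt y) x with h | h
    · rw [h] at h1 ⊢
      simp [h1]
    · simpa [h] using h1
  · intro y hy
    rcases eq_or_ne y x with rfl | h
    · intro h'
      simp only [Function.update_self] at h'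
      exact F.le_sz y hy (F.par_eq_of_par_par_eq hy h')
    · simpa [h] using F.le_sz y hy

theorem halve_isRoot_iff (F : Forest V par rk rt sz) {x y : ℕ} (hx : x < V) :
    Function.update par x (par (par x)) y = y ↔ par y = y := by
  rcases eq_or_ne y x with rfl | h
  · simp only [Function.update_self]
    exact ⟨F.par_eq_of_par_par_eq hx, fun h => by rw [h, h]⟩
  · simp [h]

theorem numRoots_halve (F : Forest V par rk rt sz) {x : ℕ} (hx : x < V) :
    numRoots V (Function.update par x (par (par x))) = numRoots V par := by
  unfold numRoots
  simp only [F.halve_isRoot_iff hx]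

theorem charge_le_charge_halve (F : Forest V par rk rt sz) {x : ℕ} (hx : x < V) :
    charge V par rk ≤ charge V (Function.update par x (par (par x))) rk := by
  unfold charge
  refine sum_le_sum fun y hy => ?_
  simp only [F.halve_isRoot_iff hx]
  split_ifs with h
  · exact le_rfl
  · rcases eq_or_ne y x with rfl | h'
    · simp only [Function.update_self]
      exact min_le_min_right _ (F.rk_le_par (F.par_lt y hx))
    · simp [h']

/-- The new parent has larger rank than the old one, and the cap `tower (level (rk x))` was not yet
reached, so the term of `x` rises by at least one. -/
theorem charge_lt_charge_halve (F : Forest V par rk rt sz) {x : ℕ} (hx : x < V) (h₁ : par x ≠ x)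
    (h₂ : par (par x) ≠ par x) (h₃ : rk (par x) < tower (level (rk x))) :
    charge V par rk < charge V (Function.update par x (par (par x))) rk := by
  unfold charge
  refine sum_lt_sum (fun y hy => ?_) ⟨x, mem_range.2 hx, ?_⟩
  · simp only [F.halve_isRoot_iff hx]
    split_ifs with h
    · exact le_rfl
    · rcases eq_or_ne y x with rfl | h'
      · simp only [Function.update_self]
        exact min_le_min_right _ (F.rk_le_par (F.par_lt y hx))
      · simp [h']
  · rw [if_neg h₁, if_neg (mt (F.halve_isRoot_iff hx).1 h₁), Function.update_self]
    have := F.rk_lt _ (F.par_lt x hx) h₂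
    omega

/-! ### Linking two roots by rank -/

variable {u w : ℕ} {rk' : ℕ → ℕ}

/-- Linking the root `u` to the root `w`. -/
theorem link (F : Forest V par rk rt sz) (hu : u < V) (hw : w < V) (huw : u ≠ w)
    (hpu : par u = u) (hpw : par w = w) (hrk : ∀ x, x ≠ w → rk' x = rk x)
    (hlt : rk u < rk' w) (hw' : rk' w = rk w ∨ (rk' w = rk w + 1 ∧ rk u = rk w)) :
    Forest V (Function.update par u w) rk' (fun x => if rt x = u then w else rt x)
      (Function.update (Function.update sz u 0) w (sz u + sz w)) := by
  have hru := hrk u huw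
  have hmono : ∀ x, rk x ≤ rk' x := by
    intro x
    rcases eq_or_ne x w with rfl | h
    · omega
    · exact (hrk x h).ge
  have hrtw : rt w = w := F.rt_self w hw hpw
  have hrtu : rt u = u := F.rt_self u hu hpu
  have hszu := F.le_sz u hu hpu
  have hszw := F.le_sz w hw hpw
  have hsz2 : 2 ^ rk' w ≤ sz u + sz w := by
    rcases hw' with h | ⟨h, h'⟩
    · rw [h]; omega
    · rw [h, pow_succ]; rw [h'] at hszu; omega
  have hsum : ∑ x ∈ range V, Function.update (Function.update sz u 0) w (sz u + sz w) x = V := by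
    obtain ⟨r, h1, h2⟩ := sum_of_eq_off_pair (f := sz)
      (g := Function.update (Function.update sz u 0) w (sz u + sz w))
      (mem_range.2 hu) (mem_range.2 hw) huw (fun x _ hxu hxw => by simp [hxu, hxw])
    rw [F.sum_sz] at h1
    simp only [Function.update_self, Function.update_of_ne huw] at h2
    omega
  refine ⟨?_, ?_, ?_, ?_, ?_, ?_, ?_, hsum, ?_, ?_⟩
  · intro x hx
    rcases eq_or_ne x u with rfl | h
    · simpa using hw
    · simpa [h] using F.par_lt x hx
  · intro x hx
    rcases eq_or_ne x u with rfl | h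
    · intro _
      simpa [hru] using hlt
    · simp only [Function.update_of_ne h]
      intro hne
      have hxw : x ≠ w := by rintro rfl; exact hne hpw
      rw [hrk x hxw]
      exact (F.rk_lt x hx hne).trans_le (hmono _)
  · intro x hx
    rcases eq_or_ne x u with rfl | h
    · simp [hrtw, hrtu, huw.symm]
    · simp [h, F.rt_par x hx]
  · intro x hx
    rcases eq_or_ne x u with rfl | h
    · intro h'
      simp only [Function.update_self] at h'
      exact absurd h'.symm huw
    · simp only [Function.update_of_ne h]
      intro h'
      simp [F.rt_self x hx h', h]
  · intro x hx
    split_ifs with h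
    · simp [huw.symm, hpw]
    · simpa [h] using F.par_rt x hx
  · intro x hx
    split_ifs
    · exact hw
    · exact F.rt_lt x hx
  · intro x hx
    rcases eq_or_ne x u with rfl | h
    · intro h'
      simp only [Function.update_self] at h'
      exact absurd h'.symm huw
    · simp only [Function.update_of_ne h]
      intro h'
      rcases eq_or_ne x w with rfl | hxw
      · simpa using hsz2
      · simpa [hxw, h, hrk x hxw] using F.le_sz x hx h'
  · intro x hx
    rcases eq_or_ne x w with rfl | hxw
    · refine hsz2.trans ?_
      calc sz u + sz x = Function.update (Function.update sz u 0) x (sz u + sz x) x := by simp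
        _ ≤ _ := single_le_sum (f := Function.update (Function.update sz u 0) x (sz u + sz x))
              (fun _ _ => Nat.zero_le _) (mem_range.2 hw)
        _ = V := hsum
    · rw [hrk x hxw]
      exact F.pow_le x hx
  -- If no rank changes, the size of `u` moves to a rank at least as high and monotonicity suffices.
  -- If the rank of `w` rises to `rk w + 1`, the merged tree has at least `2 ^ (rk w + 1)` nodes;
  -- each pays `tower / 2 ^ (rk w + 1)`, which covers the tower of the new rank.
  · obtain ⟨r, h1, h2⟩ := sum_of_eq_off_pair (f := fun x => (sz x : ℚ) * rankWeight (rk x))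
      (g := fun x => (Function.update (Function.update sz u 0) w (sz u + sz w) x : ℚ) *
        rankWeight (rk' x))
      (mem_range.2 hu) (mem_range.2 hw) huw (fun x _ hxu hxw => by simp [hxu, hxw, hrk x hxw])
    obtain ⟨r', h3, h4⟩ := sum_of_eq_off_pair (f := fun x => (tower (level (rk x)) : ℚ))
      (g := fun x => (tower (level (rk' x)) : ℚ))
      (mem_range.2 hu) (mem_range.2 hw) huw (fun x _ hxu hxw => by simp [hrk x hxw])
    have hW := F.weight
    rw [h1, h3] at hW
    rw [h2, h4]
    simp only [Function.update_self, Function.update_of_ne huw, hru, Nat.cast_zero, zero_mul,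
      zero_add]
    have hsu : (0 : ℚ) ≤ sz u := Nat.cast_nonneg _
    have hsw : (0 : ℚ) ≤ sz w := Nat.cast_nonneg _
    push_cast
    rcases hw' with h | ⟨h, h'⟩
    · have := mul_le_mul_of_nonneg_left (rankWeight_mono (show rk u ≤ rk w by omega)) hsu
      rw [h]
      linarith
    · rw [h'] at hW ⊢
      rw [h] at hsz2 ⊢
      have h5 := rankWeight_succ (rk w)
      have h6 : ((2 : ℚ) ^ (rk w + 1)) ≤ sz u + sz w := by exact_mod_cast hsz2
      have h7 : (tower (level (rk w + 1)) : ℚ) ≤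
          (sz u + sz w) * (tower (level (rk w + 1)) / 2 ^ (rk w + 1)) := by
        rw [mul_div_assoc', le_div_iff₀ (by positivity), mul_comm]
        exact mul_le_mul_of_nonneg_right h6 (Nat.cast_nonneg _)
      have h8 := mul_le_mul_of_nonneg_left h5 (add_nonneg hsu hsw)
      have h9 : (0 : ℚ) ≤ tower (level (rk w)) := Nat.cast_nonneg _
      linarith

/-- Only the rank of the root `w` can change, so the caps of the charged nodes stay fixed while the
ranks of their parents can only grow. -/
theorem charge_le_charge_link (hu : u < V) (huw : u ≠ w) (hpu : par u = u) (hpw : par w = w)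
    (hrk : ∀ x, x ≠ w → rk' x = rk x) (hw' : rk w ≤ rk' w) :
    charge V par rk ≤ charge V (Function.update par u w) rk' := by
  have hmono : ∀ x, rk x ≤ rk' x := by
    intro x
    rcases eq_or_ne x w with rfl | h
    · exact hw'
    · exact (hrk x h).ge
  refine sum_le_sum fun x _ => ?_
  rcases eq_or_ne x u with rfl | hxu
  · simp [hpu]
  · rw [Function.update_of_ne hxu]
    split_ifs with h
    · exact le_rfl
    · have hxw : x ≠ w := by rintro rfl; exact h hpw
      rw [hrk x hxw]
      exact min_le_min_right _ (hmono _)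

theorem numRoots_link (hu : u < V) (huw : u ≠ w) (hpu : par u = u) :
    numRoots V (Function.update par u w) + 1 ≤ numRoots V par := by
  refine Nat.succ_le_of_lt (card_lt_card ⟨?_, ?_⟩)
  · intro x
    simp only [mem_filter]
    rintro ⟨hx, h⟩
    rcases eq_or_ne x u with rfl | hxu
    · exact ⟨hx, hpu⟩
    · exact ⟨hx, by rwa [Function.update_of_ne hxu] at h⟩
  · intro h
    have := h (mem_filter.2 ⟨mem_range.2 hu, hpu⟩)
    simp [huw.symm] at this

end Forest

end Forest

/-! ### Reasoning about programs -/

/-- Started in memory `m`, the program `P` stops after some time `t` in some memory `m'` such that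
`Q t m'`. -/
def Run (P : Prog) (m : Mem) (Q : ℕ → Mem → Prop) : Prop :=
  ∃ t m', Exec P m t m' ∧ Q t m'

theorem Run.mono {P : Prog} {m : Mem} {Q Q' : ℕ → Mem → Prop} (h : Run P m Q)
    (hQ : ∀ t m', Q t m' → Q' t m') : Run P m Q' := by
  obtain ⟨t, m', he, hq⟩ := h
  exact ⟨t, m', he, hQ t m' hq⟩

theorem run_prim {p : Prim} {m : Mem} {Q : ℕ → Mem → Prop} :
    Run (.prim p) m Q ↔ Q 1 (p.run m) := by
  constructor
  · rintro ⟨t, m', he, hq⟩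
    cases he
    exact hq
  · exact fun h => ⟨1, _, .prim p m, h⟩

theorem run_seq {c d : Prog} {m : Mem} {Q : ℕ → Mem → Prop} :
    Run (.seq c d) m Q ↔ Run c m fun t m' => Run d m' fun t' m'' => Q (t + t') m'' := by
  constructor
  · rintro ⟨t, m', he, hq⟩
    cases he with
    | seq h1 h2 => exact ⟨_, _, h1, _, _, h2, hq⟩
  · rintro ⟨t, m', he, t', m'', he', hq⟩
    exact ⟨_, _, .seq he he', hq⟩

theorem run_ite {b : Test} {c d : Prog} {m : Mem} {Q : ℕ → Mem → Prop} :
    Run (.ite b c d) m Q ↔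
      (b.Holds m → Run c m fun t m' => Q (t + 1) m') ∧
        (¬ b.Holds m → Run d m fun t m' => Q (t + 1) m') := by
  constructor
  · rintro ⟨t, m', he, hq⟩
    cases he with
    | ite_true hb h => exact ⟨fun _ => ⟨_, _, h, hq⟩, fun hn => absurd hb hn⟩
    | ite_false hb h => exact ⟨fun hn => absurd hn hb, fun _ => ⟨_, _, h, hq⟩⟩
  · rintro ⟨h1, h2⟩
    by_cases hb : b.Holds m
    · obtain ⟨t, m', he, hq⟩ := h1 hb
      exact ⟨_, _, .ite_true hb he, hq⟩
    · obtain ⟨t, m', he, hq⟩ := h2 hb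
      exact ⟨_, _, .ite_false hb he, hq⟩

/-- The rule for loops: `I k τ m` is an invariant in which `k` decreases and `τ` is the time spent
so far. -/
theorem run_loop {b : Test} {c : Prog} (I : ℕ → ℕ → Mem → Prop)
    (step : ∀ k τ m, I k τ m → b.Holds m → Run c m fun t m' => ∃ k' < k, I k' (τ + t + 1) m')
    {k τ : ℕ} {m : Mem} (h : I k τ m) :
    Run (.loop b c) m fun t m' => ∃ k' τ', I k' τ' m' ∧ ¬ b.Holds m' ∧ τ' + 1 = τ + t := by
  induction k using Nat.strong_induction_on generalizing τ m with
  | _ k ih =>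
    by_cases hb : b.Holds m
    · obtain ⟨t, m', he, k', hk, hI⟩ := step k τ m h hb
      obtain ⟨t', m'', he', k'', τ', hI', hb', ht⟩ := ih k' hk hI
      exact ⟨_, _, .loop_step hb he he', k'', τ', hI', hb', by omega⟩
    · exact ⟨_, _, .loop_done hb, k, τ, h, hb, rfl⟩

/-- The rule for loops in which the variable `i` runs from `0` to the value `N` of `l`. -/
theorem run_for {i l N : ℕ} {c : Prog} (I : ℕ → ℕ → Mem → Prop)
    (hI : ∀ j τ m, I j τ m → j ≤ N ∧ m.reg i = j ∧ m.reg l = N)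
    (step : ∀ j < N, ∀ τ m, I j τ m → Run c m fun t m' => I (j + 1) (τ + t + 1) m')
    {τ : ℕ} {m : Mem} (h : I 0 τ m) :
    Run (.loop (.lt i l) c) m fun t m' => ∃ τ', I N τ' m' ∧ τ' + 1 = τ + t := by
  refine (run_loop (fun k τ m => k ≤ N ∧ I (N - k) τ m) ?_ (k := N) (τ := τ) ?_).mono ?_
  · rintro k τ m ⟨hk, h⟩ hb
    obtain ⟨-, h1, h2⟩ := hI _ _ _ h
    have hb' : m.reg i < m.reg l := hb
    refine (step _ (by omega) τ m h).mono fun t m' h' => ?_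
    refine ⟨k - 1, by omega, by omega, ?_⟩
    rwa [show N - (k - 1) = N - k + 1 by omega]
  · simpa using h
  · rintro t m' ⟨k, τ', ⟨hk, h⟩, hb, ht⟩
    obtain ⟨-, h1, h2⟩ := hI _ _ _ h
    have hb' : ¬ m'.reg i < m'.reg l := hb
    refine ⟨τ', ?_, ht⟩
    rwa [show N - k = N by omega] at h

/-- The programs `f 0`, …, `f (K - 1)` in succession. -/
def unroll (f : ℕ → Prog) : ℕ → Prog
  | 0 => .prim .skip
  | K + 1 => .seq (unroll f K) (f K)

theorem run_unroll {f : ℕ → Prog} {K : ℕ} (I : ℕ → ℕ → Mem → Prop)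
    (step : ∀ k < K, ∀ τ m, I k τ m → Run (f k) m fun t m' => I (k + 1) (τ + t) m')
    {τ : ℕ} {m : Mem} (h : I 0 τ m) :
    Run (unroll f K) m fun t m' => ∃ τ', I K τ' m' ∧ τ' + 1 = τ + t := by
  induction K with
  | zero =>
    rw [unroll, run_prim]
    exact ⟨τ, h, rfl⟩
  | succ K ih =>
    rw [unroll, run_seq]
    refine (ih fun k hk => step k (by omega)).mono ?_
    rintro t m' ⟨τ', h', ht⟩
    refine (step K (by omega) τ' m' h').mono fun t' m'' h'' => ⟨_, h'', by omega⟩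

/-- Run `f k`, where `k < K` is the value of the variable `r`, using the variable `s`. -/
def dispatch (r s : ℕ) (f : ℕ → Prog) : ℕ → Prog
  | 0 => .prim .skip
  | K + 1 => .seq (.prim (.const s K)) (.ite (.eq r s) (f K) (dispatch r s f K))

/-- The name of a unary function is fixed in the program text, so a label read from memory must
select code by comparison with each constant. Every comparison costs two units, which is constant
for a fixed alphabet. -/
theorem run_dispatch {r s : ℕ} (hrs : r ≠ s) {f : ℕ → Prog} {K : ℕ} {m : Mem}
    {Q : ℕ → Mem → Prop} (hK : m.reg r < K)
    (h : Run (f (m.reg r)) { m with reg := Function.update m.reg s (m.reg r) } Q) :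
    Run (dispatch r s f K) m fun t m' => ∃ t', Q t' m' ∧ t ≤ t' + 2 * K := by
  induction K generalizing m with
  | zero => omega
  | succ K ih =>
    rw [dispatch, run_seq, run_prim, run_ite]
    simp only [Prim.run, Test.Holds, Function.update_self, Function.update_of_ne hrs]
    constructor
    · rintro rfl
      exact h.mono fun t m' hq => ⟨t, hq, by omega⟩
    · intro hne
      refine (ih (by simpa [hrs] using (by omega : m.reg r < K)) ?_).mono ?_
      · simpa [hrs] using h
      · rintro t m' ⟨t', hq, ht⟩
        exact ⟨t', hq, by omega⟩

/-! ### Finding roots -/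

/-- Replace the vertex in the variable 10 by its root, halving the path to it. The function 4 holds
the parents. -/
def findRoot : Prog :=
  .seq (.prim (.load 11 4 10)) (.loop (.ne 11 10)
    (.seq (.prim (.load 11 4 11)) (.seq (.prim (.store 4 10 11))
      (.seq (.prim (.copy 10 11)) (.prim (.load 11 4 10))))))

/-- The memories `m` and `m'` hold the same data, except that paths in the forest with parents in
the function 4 may have been shortened, and the variables 10 and 11 may have been changed. -/
structure Compressed (V : ℕ) (rt sz : ℕ → ℕ) (m m' : Mem) : Prop where
  forest : Forest V (m'.fld 4) (m'.fld 5) rt sz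
  reg : ∀ r, r ≠ 10 → r ≠ 11 → m'.reg r = m.reg r
  fld : ∀ f, f ≠ 4 → m'.fld f = m.fld f
  numRoots_eq : numRoots V (m'.fld 4) = numRoots V (m.fld 4)
  charge_le : charge V (m.fld 4) (m.fld 5) ≤ charge V (m'.fld 4) (m'.fld 5)

theorem run_findRoot {V : ℕ} {rt sz : ℕ → ℕ} {m : Mem}
    (F : Forest V (m.fld 4) (m.fld 5) rt sz) (hx : m.reg 10 < V) :
    Run findRoot m fun t m' => Compressed V rt sz m m' ∧ m'.reg 10 = rt (m.reg 10) ∧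
      t + 5 * charge V (m.fld 4) (m.fld 5) ≤
        5 * charge V (m'.fld 4) (m'.fld 5) + 5 * logStar V + 7 := by
  rw [findRoot, run_seq, run_prim]
  -- A round of the loop takes 5 units. It is paid for by an increase of the charge, by a rise in
  -- level, or by the final 5, available only once a root is reached. The measure `k` decreases
  -- because ranks increase along the path.
  refine (run_loop (fun k τ m₁ => Compressed V rt sz m m₁ ∧ m₁.reg 10 < V ∧
    m₁.reg 11 = m₁.fld 4 (m₁.reg 10) ∧ rt (m₁.reg 10) = rt (m.reg 10) ∧
    k = V - m₁.fld 5 (m₁.reg 10) ∧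
    τ + 5 * charge V (m.fld 4) (m.fld 5) ≤ 5 * charge V (m₁.fld 4) (m₁.fld 5) +
      5 * level (m₁.fld 5 (m₁.reg 10)) + if m₁.reg 11 = m₁.reg 10 then 5 else 0)
    ?_ (τ := 0) (k := V - m.fld 5 (m.reg 10)) ?_).mono ?_
  · rintro k τ m₁ ⟨⟨F₁, hreg, hfld, hnum, hch⟩, hx₁, hp, hrt, hk, hτ⟩ hb
    have hb' : m₁.reg 11 ≠ m₁.reg 10 := hb
    rw [if_neg hb'] at hτ
    rw [hp] at hb'
    have hpV := F₁.par_lt _ hx₁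
    have hgV := F₁.par_lt _ hpV
    have h1 := F₁.rk_lt _ hx₁ hb'
    have h2 := F₁.rk_le_par hpV
    have h3 := F₁.rk_lt_card hgV
    simp only [run_seq, run_prim, Prim.run, Function.update_self, hp, ne_eq, 
      Nat.reduceEqDiff, not_false_eq_true, Function.update_of_ne]
    generalize m₁.reg 10 = x at *
    have hm := F₁.charge_le_charge_halve hx₁
    refine ⟨_, ?_, ⟨F₁.halve hx₁, ?_, ?_, ?_, ?_⟩, hgV, trivial, ?_, rfl, ?_⟩
    · omega
    · intro r h10 h11
      simp [h10, h11, hreg r h10 h11]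
    · intro f hf
      simp [hf, hfld f hf]
    · exact (F₁.numRoots_halve hx₁).trans hnum
    · exact hch.trans hm
    · rw [F₁.rt_par _ hpV, F₁.rt_par _ hx₁, hrt]
    · have hl := level_mono (h1.le.trans h2)
      by_cases hroot : m₁.fld 4 (m₁.fld 4 x) = m₁.fld 4 x
      · rw [if_pos]
        · omega
        · rw [hroot, Function.update_of_ne hb', hroot]
      · by_cases hlt : m₁.fld 5 (m₁.fld 4 x) < tower (level (m₁.fld 5 x))
        · have := F₁.charge_lt_charge_halve hx₁ hb' hroot hlt
          omega
        · have h4 := level_lt_of_tower_le (not_lt.1 hlt)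
          have h5 := level_mono h2
          omega
  · refine ⟨⟨F, fun r h10 h11 => by simp [Prim.run, h11], fun _ _ => rfl, rfl, le_rfl⟩, ?_⟩
    refine ⟨by simpa [Prim.run] using hx, by simp [Prim.run], by simp [Prim.run], rfl, ?_⟩
    simp only [Prim.run]
    omega
  · rintro t m' ⟨k, τ, ⟨hC, hx', hp, hrt, hk, hτ⟩, hb, ht⟩
    have hb' : m'.reg 11 = m'.reg 10 := not_not.1 hb
    rw [if_pos hb'] at hτ
    refine ⟨hC, ?_, ?_⟩
    · rw [← hrt]
      exact (hC.forest.rt_self _ hx' (hp ▸ hb')).symm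
    · have := hC.forest.level_le hx'
      omega

/-! ### Tables of half-edges and the queue of pending identifications -/

/-- `c` is compatible with folding the half-edges `H`, where `H a k b` means that there is a
half-edge of type `k` from `a` to `b`. -/
def HalfClosed {α : Type} (H : ℕ → ℕ → ℕ → Prop) (c : ℕ → α) : Prop :=
  ∀ a k b a₁ b₁, H a k b → H a₁ k b₁ → c a = c a₁ → c b = c b₁

/-- `T k x` is the target of the half-edge of type `k` at `x`, or `V` if there is none. The pairs
`(qa i, qb i)` with `i < tl` are to be identified; this has been done for `i < hd`. Everything in
the tables holds modulo `c`. Modulo `rt` and the pending pairs, there is a half-edge of type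
`k` from `x` to `b` whenever `O x k b`. -/
structure Tables {α : Type} (V K : ℕ) (H : ℕ → ℕ → ℕ → Prop) (c : ℕ → α) (rt : ℕ → ℕ)
    (O : ℕ → ℕ → ℕ → Prop) (T : ℕ → ℕ → ℕ) (qa qb : ℕ → ℕ) (hd tl : ℕ) : Prop where
  T_le : ∀ k < K, ∀ v < V, T k v ≤ V
  q_lt : ∀ i < tl, qa i < V ∧ qb i < V
  hd_le : hd ≤ tl
  c_rt : ∀ v < V, c (rt v) = c v
  c_q : ∀ i < tl, c (qa i) = c (qb i)
  T_sound : ∀ k < K, ∀ v < V, T k v ≠ V → ∃ a b, H a k b ∧ c a = c v ∧ c b = c (T k v)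
  complete : ∀ x k b, O x k b → T k x ≠ V ∧ ∀ f : ℕ → ℕ, (∀ v < V, f (rt v) = f v) →
    (∀ i, hd ≤ i → i < tl → f (qa i) = f (qb i)) → f (T k x) = f b

namespace Tables

variable {α : Type} {V K : ℕ} {H O : ℕ → ℕ → ℕ → Prop} {c : ℕ → α} {rt : ℕ → ℕ}
  {T T' : ℕ → ℕ → ℕ} {qa qb : ℕ → ℕ} {hd tl k v b : ℕ}

theorem congr_obligations {O' : ℕ → ℕ → ℕ → Prop} (h : Tables V K H c rt O T qa qb hd tl)
    (hO : ∀ x k b, O' x k b → O x k b) : Tables V K H c rt O' T qa qb hd tl :=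
  { h with complete := fun x k b hx => h.complete x k b (hO x k b hx) }

theorem store (h : Tables V K H c rt O T qa qb hd tl) (hb : b < V) (hV : T k v = V)
    (hs : ∃ a b', H a k b' ∧ c a = c v ∧ c b' = c b)
    (hT : ∀ j x, T' j x = if j = k ∧ x = v then b else T j x) :
    Tables V K H c rt (fun x j y => O x j y ∨ (x = v ∧ j = k ∧ y = b)) T' qa qb hd tl := by
  refine { h with T_le := ?_, T_sound := ?_, complete := ?_ }
  · intro j hj x hx
    rw [hT]
    split_ifs
    · exact hb.le
    · exact h.T_le j hj x hx
  · intro j hj x hx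
    rw [hT]
    split_ifs with he
    · obtain ⟨rfl, rfl⟩ := he
      exact fun _ => hs
    · exact h.T_sound j hj x hx
  · rintro x j y (hx | ⟨rfl, rfl, rfl⟩)
    · have h1 := h.complete x j y hx
      have : ¬ (j = k ∧ x = v) := by
        rintro ⟨rfl, rfl⟩
        exact h1.1 hV
      rwa [hT, if_neg this]
    · rw [hT, if_pos ⟨rfl, rfl⟩]
      exact ⟨hb.ne, fun _ _ _ => rfl⟩

/-- The occupied entry stays. The new pair respects `c`, because the old and the new target both
come from half-edges of type `k` at vertices of the same `c`-class. The new obligation is met modulo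
this pair: a test function `f` constant on pending pairs takes the same value at both targets. -/
theorem push (h : Tables V K H c rt O T qa qb hd tl) (hc : HalfClosed H c) (hk : k < K)
    (hv : v < V) (hb : b < V) (hV : T k v ≠ V) (hs : ∃ a b', H a k b' ∧ c a = c v ∧ c b' = c b) :
    Tables V K H c rt (fun x j y => O x j y ∨ (x = v ∧ j = k ∧ y = b)) T
      (Function.update qa tl b) (Function.update qb tl (T k v)) hd (tl + 1) := by
  refine { h with hd_le := h.hd_le.trans (Nat.le_succ _), q_lt := ?_, c_q := ?_, complete := ?_ }
  · intro i hi
    rcases eq_or_ne i tl with rfl | hne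
    · have := h.T_le k hk v hv
      simp only [Function.update_self]
      omega
    · simpa [hne] using h.q_lt i (by omega)
  · intro i hi
    rcases eq_or_ne i tl with rfl | hne
    · simp only [Function.update_self]
      obtain ⟨a, b', h1, h2, h3⟩ := hs
      obtain ⟨a', b'', h1', h2', h3'⟩ := h.T_sound k hk v hv hV
      rw [← h3, ← h3']
      exact hc _ _ _ _ _ h1 h1' (h2.trans h2'.symm)
    · simpa [hne] using h.c_q i (by omega)
  · rintro x j y (hx | ⟨rfl, rfl, rfl⟩)
    · refine ⟨(h.complete x j y hx).1, fun f hf hq => (h.complete x j y hx).2 f hf ?_⟩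
      intro i h1 h2
      have := hq i h1 (by omega)
      rwa [Function.update_of_ne (by omega), Function.update_of_ne (by omega)] at this
    · refine ⟨hV, fun f hf hq => ?_⟩
      have := hq tl h.hd_le (by omega)
      simpa using this.symm

/-- The first pending pair may be dropped when its members have been identified. -/
theorem pop {rt' : ℕ → ℕ} (h : Tables V K H c rt O T qa qb hd tl) (hlt : hd < tl)
    (hc : ∀ v < V, c (rt' v) = c v)
    (hrt : ∀ f : ℕ → ℕ, (∀ v < V, f (rt' v) = f v) →
      (∀ v < V, f (rt v) = f v) ∧ f (qa hd) = f (qb hd)) :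
    Tables V K H c rt' O T qa qb (hd + 1) tl := by
  refine { h with hd_le := hlt, c_rt := hc, complete := ?_ }
  intro x k b hx
  refine ⟨(h.complete x k b hx).1, fun f hf hq => ?_⟩
  refine (h.complete x k b hx).2 f (hrt f hf).1 fun i h1 h2 => ?_
  rcases eq_or_ne i hd with rfl | hne
  · exact (hrt f hf).2
  · exact hq i (by omega) h2

end Tables

/-- The tables in memory: the functions `10 + k` hold the half-edges, the functions 6 and 7 the
queue, whose ends are in the variables 4 and 5. -/
def Mem.HasTables {α : Type} (m : Mem) (V K : ℕ) (H : ℕ → ℕ → ℕ → Prop) (c : ℕ → α) (rt : ℕ → ℕ)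
    (O : ℕ → ℕ → ℕ → Prop) : Prop :=
  Tables V K H c rt O (fun k => m.fld (k + 10)) (m.fld 6) (m.fld 7) (m.reg 4) (m.reg 5)

/-- Record that there is a half-edge of type `k` from the vertex in the variable 20 to the vertex
in the variable 21. -/
def putHalfEdge (k : ℕ) : Prog :=
  .seq (.prim (.load 22 (k + 10) 20)) (.ite (.eq 22 0) (.prim (.store (k + 10) 20 21))
    (.seq (.prim (.store 6 5 21)) (.seq (.prim (.store 7 5 22)) (.prim (.succ 5)))))

theorem run_putHalfEdge {α : Type} {V K : ℕ} {H O : ℕ → ℕ → ℕ → Prop} {c : ℕ → α} {rt : ℕ → ℕ}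
    {m : Mem} {k : ℕ} (h : m.HasTables V K H c rt O) (hc : HalfClosed H c) (hk : k < K)
    (h0 : m.reg 0 = V) (hv : m.reg 20 < V) (hb : m.reg 21 < V)
    (hs : ∃ a b', H a k b' ∧ c a = c (m.reg 20) ∧ c b' = c (m.reg 21)) :
    Run (putHalfEdge k) m fun t m' =>
      m'.HasTables V K H c rt (fun x j y => O x j y ∨ (x = m.reg 20 ∧ j = k ∧ y = m.reg 21)) ∧
      (∀ r, r ≠ 22 → r ≠ 5 → m'.reg r = m.reg r) ∧ m'.reg 5 ≤ m.reg 5 + 1 ∧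
      (∀ f < 10, f ≠ 6 → f ≠ 7 → m'.fld f = m.fld f) ∧
      (∀ j x, x ≠ m.reg 20 → m'.fld (j + 10) x = m.fld (j + 10) x) ∧ t ≤ 5 := by
  simp only [putHalfEdge, run_seq, run_ite, run_prim, Prim.run, Test.Holds, Function.update_self,
    ne_eq, OfNat.zero_ne_ofNat, Nat.reduceEqDiff,
    not_false_eq_true, Function.update_of_ne, h0]
  constructor
  · intro hV
    refine ⟨?_, ?_, by simp, ?_, ?_, by simp⟩
    · have := Tables.store h hb hV hs (T' := fun j => Function.update m.fld (k + 10)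
        (Function.update (m.fld (k + 10)) (m.reg 20) (m.reg 21)) (j + 10)) (by
          intro j x
          rcases eq_or_ne j k with rfl | hj
          · by_cases hx : x = m.reg 20 <;> simp [hx]
          · simp [hj])
      simpa [Mem.HasTables] using this
    · intro r h22 h5
      simp [h22]
    · intro f hf _ _
      rw [Function.update_of_ne (by omega)]
    · intro j x hx
      rcases eq_or_ne j k with rfl | hj
      · simp [hx]
      · simp [hj]
  · intro hV
    refine ⟨?_, ?_, by simp, ?_, ?_, by simp⟩
    · have := Tables.push h hc hk hv hb hV hs
      simpa [Mem.HasTables] using this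
    · intro r h22 h5
      simp [h22, h5]
    · intro f hf h6 h7
      simp [h6, h7]
    · intro j x hx
      simp

/-! ### Setting up the forest and the tables -/

/-- Make every vertex a tree of its own, with an empty table. -/
def setUp (n : ℕ) : Prog :=
  .seq (.prim (.const 3 0)) (.seq (.prim (.const 9 0)) (.seq (.prim (.const 4 0))
    (.seq (.prim (.const 5 0)) (.loop (.lt 3 0) (.seq (.prim (.store 4 3 3))
      (.seq (.prim (.store 5 3 9)) (.seq (unroll (fun k => .prim (.store (k + 10) 3 0)) (2 * n))
        (.prim (.succ 3)))))))))

theorem run_setUp (n : ℕ) (m : Mem) :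
    Run (setUp n) m fun t m' => (∀ v < m.reg 0, m'.fld 4 v = v) ∧ (∀ v < m.reg 0, m'.fld 5 v = 0) ∧
      (∀ k < 2 * n, ∀ v < m.reg 0, m'.fld (k + 10) v = m.reg 0) ∧
      m'.reg 0 = m.reg 0 ∧ m'.reg 1 = m.reg 1 ∧ m'.reg 4 = 0 ∧ m'.reg 5 = 0 ∧
      (∀ f < 4, m'.fld f = m.fld f) ∧ t ≤ (2 * n + 5) * m.reg 0 + 5 := by
  simp only [setUp, run_seq, run_prim, Prim.run]
  refine (run_for (N := m.reg 0) (fun j τ m₁ => j ≤ m.reg 0 ∧ (∀ v < j, m₁.fld 4 v = v) ∧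
    (∀ v < j, m₁.fld 5 v = 0) ∧ (∀ k < 2 * n, ∀ v < j, m₁.fld (k + 10) v = m.reg 0) ∧
    m₁.reg 0 = m.reg 0 ∧ m₁.reg 1 = m.reg 1 ∧ m₁.reg 4 = 0 ∧ m₁.reg 5 = 0 ∧ m₁.reg 9 = 0 ∧
    m₁.reg 3 = j ∧ (∀ f < 4, m₁.fld f = m.fld f) ∧ τ = (2 * n + 5) * j) ?_ ?_ (τ := 0) ?_).mono ?_
  · rintro j τ m₁ ⟨hj, -, -, -, h0, -, -, -, -, h3, -⟩
    exact ⟨hj, h3, h0⟩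
  · rintro j hj τ m₁ ⟨-, h4, h5, hT, h0, h1, hr4, hr5, h9, h3, hf, hτ⟩
    simp only [run_seq, run_prim, Prim.run]
    refine (run_unroll (fun k τ' m₂ => m₂.reg = m₁.reg ∧ (∀ v < j + 1, m₂.fld 4 v = v) ∧
      (∀ v < j + 1, m₂.fld 5 v = 0) ∧ (∀ i < 2 * n, ∀ v < j, m₂.fld (i + 10) v = m.reg 0) ∧
      (∀ i < k, m₂.fld (i + 10) j = m.reg 0) ∧
      (∀ f < 4, m₂.fld f = m.fld f) ∧ τ' = k) ?_ (τ := 0) ?_).mono ?_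
    · rintro k hk τ' m₂ ⟨hreg, h4', h5', hT', hk', hf', hτ'⟩
      rw [run_prim]
      simp only [Prim.run, hreg, h3, h0]
      refine ⟨trivial, ?_, ?_, ?_, ?_, ?_, by omega⟩
      · simpa using h4'
      · simpa using h5'
      · intro i hi v hv
        rcases eq_or_ne i k with rfl | hne
        · simp [hv.ne, hT' i hi v hv]
        · simp [hne, hT' i hi v hv]
      · intro i hi
        rcases eq_or_ne i k with rfl | hne
        · simp
        · simp [hne, hk' i (by omega)]
      · intro f hf
        rw [Function.update_of_ne (by omega)]
        exact hf' f hf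
    · refine ⟨rfl, ?_, ?_, ?_, by simp, ?_, rfl⟩
      · intro v hv
        rcases eq_or_ne v j with rfl | hne
        · simp [h3]
        · simp [h3, hne, h4 v (by omega)]
      · intro v hv
        rcases eq_or_ne v j with rfl | hne
        · simp [h3, h9]
        · simp [h3, hne, h5 v (by omega)]
      · simpa using hT
      · intro f hf'
        simp [show f ≠ 4 by omega, show f ≠ 5 by omega, hf f hf']
    · rintro t m₂ ⟨τ', ⟨hreg, h4', h5', hT', hk', hf', hτ'⟩, ht⟩
      refine ⟨hj, h4', h5', ?_, ?_⟩
      · intro i hi v hv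
        rcases eq_or_ne v j with rfl | hne
        · exact hk' i hi
        · exact hT' i hi v (by omega)
      · simp only [hreg, h3, Function.update_self, ne_eq, OfNat.zero_ne_ofNat, Nat.reduceEqDiff,
          OfNat.one_ne_ofNat, not_false_eq_true, Function.update_of_ne, h0, h1, hr4, hr5, h9]
        refine ⟨trivial, trivial, trivial, trivial, trivial, trivial, hf', ?_⟩
        rw [mul_add, ← hτ]
        omega
  · simp
  · rintro t m' ⟨τ', ⟨-, h4, h5, hT, h0, h1, hr4, hr5, -, -, hf, hτ⟩, ht⟩
    exact ⟨h4, h5, hT, h0, h1, hr4, hr5, hf, by omega⟩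

/-! ### Entering the edges into the tables -/

/-- The half-edges of the graph with edges `0, …, E - 1`: an edge from `a` to `b` with label `k`
yields a half-edge of type `k` from `a` to `b`, and one of type `k + n` from `b` to `a`. -/
def halfEdge (n : ℕ) (ini ter lab : ℕ → ℕ) (E a k b : ℕ) : Prop :=
  ∃ e < E, (a = ini e ∧ k = lab e ∧ b = ter e) ∨ (a = ter e ∧ k = lab e + n ∧ b = ini e)

/-- Enter the two half-edges of each edge into the tables. -/
def enterEdges (n : ℕ) : Prog :=
  .seq (.prim (.const 3 0)) (.loop (.lt 3 1) (.seq (.prim (.load 20 0 3))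
    (.seq (.prim (.load 21 1 3)) (.seq (.prim (.load 23 2 3)) (.seq (dispatch 23 24 (fun k => .seq (putHalfEdge k)
      (.seq (.prim (.copy 25 20)) (.seq (.prim (.copy 20 21)) (.seq (.prim (.copy 21 25))
        (putHalfEdge (k + n)))))) n)
      (.prim (.succ 3)))))))

theorem run_enterEdges {α : Type} {n V E : ℕ} {ini ter lab : ℕ → ℕ} {c : ℕ → α} {m : Mem}
    (hini : ∀ e < E, ini e < V) (hter : ∀ e < E, ter e < V) (hlab : ∀ e < E, lab e < n)
    (hc : HalfClosed (halfEdge n ini ter lab E) c)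
    (hm : m.HasTables V (2 * n) (halfEdge n ini ter lab E) c (fun x => x) fun _ _ _ => False)
    (h0 : m.reg 0 = V) (h1 : m.reg 1 = E) (h5 : m.reg 5 = 0)
    (hf0 : m.fld 0 = ini) (hf1 : m.fld 1 = ter) (hf2 : m.fld 2 = lab) :
    Run (enterEdges n) m fun t m' =>
      m'.HasTables V (2 * n) (halfEdge n ini ter lab E) c (fun x => x)
        (halfEdge n ini ter lab E) ∧ m'.reg 0 = V ∧ m'.reg 5 ≤ m'.reg 4 + 2 * E ∧
      m'.fld 4 = m.fld 4 ∧ m'.fld 5 = m.fld 5 ∧ t ≤ (2 * n + 18) * E + 2 := by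
  simp only [enterEdges, run_seq, run_prim, Prim.run]
  refine (run_for (N := E) (fun j τ m₁ => j ≤ E ∧
    m₁.HasTables V (2 * n) (halfEdge n ini ter lab E) c (fun x => x)
      (halfEdge n ini ter lab j) ∧
    m₁.reg 0 = V ∧ m₁.reg 1 = E ∧ m₁.reg 3 = j ∧ m₁.reg 5 ≤ 2 * j ∧
    (∀ f < 10, f ≠ 6 → f ≠ 7 → m₁.fld f = m.fld f) ∧ τ ≤ (2 * n + 18) * j)
    ?_ ?_ (τ := 0) ?_).mono ?_
  · rintro j τ m₁ ⟨hj, -, -, h1, h3, -⟩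
    exact ⟨hj, h3, h1⟩
  · rintro j hj τ m₁ ⟨-, hT, h0, h1, h3, h5, hf, hτ⟩
    have e0 : m₁.fld 0 = ini := (hf 0 (by simp) (by simp) (by simp)).trans hf0
    have e1 : m₁.fld 1 = ter := (hf 1 (by simp) (by simp) (by simp)).trans hf1
    have e2 : m₁.fld 2 = lab := (hf 2 (by simp) (by simp) (by simp)).trans hf2
    simp only [run_seq, run_prim, Prim.run, e0, e1, e2, h3, ne_eq, Nat.reduceEqDiff,
      not_false_eq_true, Function.update_of_ne]
    have hlj := hlab j hj
    refine (run_dispatch (by simp) (Q := fun t m' =>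
      m'.HasTables V (2 * n) (halfEdge n ini ter lab E) c (fun x => x)
        (halfEdge n ini ter lab (j + 1)) ∧ m'.reg 0 = V ∧ m'.reg 1 = E ∧ m'.reg 3 = j ∧
      m'.reg 5 ≤ 2 * (j + 1) ∧ (∀ f < 10, f ≠ 6 → f ≠ 7 → m'.fld f = m.fld f) ∧ t ≤ 13)
      (by simpa using hlj) ?_).mono ?_
    · simp only [Function.update_self, run_seq, run_prim, Prim.run]
      refine (run_putHalfEdge (V := V) (K := 2 * n) (O := halfEdge n ini ter lab j)
        (rt := fun x => x) (H := halfEdge n ini ter lab E) ?_ hc (by omega) ?_ ?_ ?_ ?_).mono ?_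
      · simpa [Mem.HasTables] using hT
      · simpa using h0
      · simpa using hini j hj
      · simpa using hter j hj
      · exact ⟨ini j, ter j, ⟨j, hj, Or.inl ⟨rfl, rfl, rfl⟩⟩, by simp, by simp⟩
      rintro t₁ m₂ ⟨hT₂, hreg₂, h5₂, hf₂, -, ht₁⟩
      simp only [ne_eq, Nat.reduceEqDiff, not_false_eq_true, Function.update_of_ne,
        Function.update_self] at hT₂ h5₂
      have r20 : m₂.reg 20 = ini j := by rw [hreg₂ 20 (by simp) (by simp)]; simp
      have r21 : m₂.reg 21 = ter j := by rw [hreg₂ 21 (by simp) (by simp)]; simp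
      have r0 : m₂.reg 0 = V := by rw [hreg₂ 0 (by simp) (by simp)]; simpa using h0
      have r1 : m₂.reg 1 = E := by rw [hreg₂ 1 (by simp) (by simp)]; simpa using h1
      have r3 : m₂.reg 3 = j := by rw [hreg₂ 3 (by simp) (by simp)]; simpa using h3
      refine (run_putHalfEdge (V := V) (K := 2 * n) (rt := fun x => x)
        (O := fun x i y => halfEdge n ini ter lab j x i y ∨ (x = ini j ∧ i = lab j ∧ y = ter j))
        (H := halfEdge n ini ter lab E) ?_ hc (by omega) ?_ ?_ ?_ ?_).mono ?_
      · simpa [Mem.HasTables] using hT₂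
      · simpa using r0
      · simpa [r21] using hter j hj
      · simpa [r20] using hini j hj
      · exact ⟨ter j, ini j, ⟨j, hj, Or.inr ⟨rfl, rfl, rfl⟩⟩, by simp [r21], by simp [r20]⟩
      rintro t₂ m₃ ⟨hT₃, hreg₃, h5₃, hf₃, -, ht₂⟩
      simp only [ne_eq, Nat.reduceEqDiff, not_false_eq_true, Function.update_of_ne,
        Function.update_self, r20, r21] at hT₃ h5₃
      refine ⟨?_, ?_, ?_, ?_, by omega, ?_, by omega⟩
      · refine hT₃.congr_obligations ?_
        rintro x k b ⟨e, he, h⟩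
        rcases Nat.lt_succ_iff_lt_or_eq.1 he with he | rfl
        · exact Or.inl (Or.inl ⟨e, he, h⟩)
        · tauto
      · rw [hreg₃ 0 (by simp) (by simp)]; simpa using r0
      · rw [hreg₃ 1 (by simp) (by simp)]; simpa using r1
      · rw [hreg₃ 3 (by simp) (by simp)]; simpa using r3
      · intro f h10 h6 h7
        rw [hf₃ f h10 h6 h7, hf₂ f h10 h6 h7, hf f h10 h6 h7]
    · rintro t m' ⟨t', ⟨hT', h0', h1', h3', h5', hf', ht'⟩, ht⟩
      refine ⟨hj, ?_, by simpa using h0', by simpa using h1', by simp [h3'], by simpa using h5',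
        hf', ?_⟩
      · simpa [Mem.HasTables] using hT'
      · rw [mul_add]
        omega
  · refine ⟨Nat.zero_le _, ?_, by simpa using h0, by simpa using h1, by simp, by simp [h5],
      fun _ _ _ _ => rfl, by simp⟩
    have : m.HasTables V (2 * n) (halfEdge n ini ter lab E) c (fun x => x)
      (halfEdge n ini ter lab 0) := by
      refine hm.congr_obligations ?_
      rintro x k b ⟨e, he, -⟩
      omega
    simpa [Mem.HasTables] using this
  · rintro t m' ⟨τ', ⟨-, hT, h0, h1, h3, h5, hf, hτ⟩, ht⟩
    exact ⟨hT, h0, by omega, hf 4 (by simp) (by simp) (by simp),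
      hf 5 (by simp) (by simp) (by simp), by omega⟩

/-! ### Processing the queue -/

/-- Link the distinct roots in the variables 13 and 10 by rank; afterwards the variable 13 holds
the child and the variable 20 the root. -/
def linkRoots : Prog :=
  .seq (.prim (.load 15 5 13)) (.seq (.prim (.load 16 5 10))
    (.seq (.ite (.lt 15 16) (.prim .skip) (.ite (.lt 16 15)
        (.seq (.prim (.copy 17 13)) (.seq (.prim (.copy 13 10)) (.prim (.copy 10 17))))
        (.seq (.prim (.succ 16)) (.prim (.store 5 10 16)))))
      (.seq (.prim (.store 4 13 10)) (.prim (.copy 20 10)))))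

theorem run_linkRoots {V u₀ w₀ : ℕ} {rt sz : ℕ → ℕ} {m : Mem}
    (F : Forest V (m.fld 4) (m.fld 5) rt sz) (hu₀ : m.reg 13 = u₀) (hw₀ : m.reg 10 = w₀)
    (hu : u₀ < V) (hw : w₀ < V) (huw : u₀ ≠ w₀) (hpu : m.fld 4 u₀ = u₀) (hpw : m.fld 4 w₀ = w₀) :
    Run linkRoots m fun t m' => ∃ u w sz', ((u = u₀ ∧ w = w₀) ∨ (u = w₀ ∧ w = u₀)) ∧
      m'.reg 13 = u ∧ m'.reg 20 = w ∧
      Forest V (m'.fld 4) (m'.fld 5) (fun x => if rt x = u then w else rt x) sz' ∧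
      charge V (m.fld 4) (m.fld 5) ≤ charge V (m'.fld 4) (m'.fld 5) ∧
      numRoots V (m'.fld 4) + 1 ≤ numRoots V (m.fld 4) ∧
      (∀ r < 10, m'.reg r = m.reg r) ∧ (∀ f, f ≠ 4 → f ≠ 5 → m'.fld f = m.fld f) ∧ t ≤ 9 := by
  have hreg : ∀ r < 10, r ≠ 10 ∧ r ≠ 13 ∧ r ≠ 15 ∧ r ≠ 16 ∧ r ≠ 17 ∧ r ≠ 20 := by omega
  simp only [linkRoots, run_seq, run_ite, run_prim, Prim.run, Test.Holds, Function.update_self,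
    ne_eq, Nat.reduceEqDiff, not_false_eq_true, Function.update_of_ne, hu₀, hw₀]
  refine ⟨fun hlt => ?_, fun hnlt => ⟨fun hlt => ?_, fun hnlt' => ?_⟩⟩
  · refine ⟨u₀, w₀, _, Or.inl ⟨rfl, rfl⟩, rfl, rfl,
      F.link hu hw huw hpu hpw (fun _ _ => rfl) hlt (Or.inl rfl),
      Forest.charge_le_charge_link hu huw hpu hpw (fun _ _ => rfl) le_rfl,
      Forest.numRoots_link hu huw hpu, ?_, ?_, by simp⟩
    · intro r hr
      simp [hreg r hr]
    · intro f h4 h5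
      simp [h4]
  · refine ⟨w₀, u₀, _, Or.inr ⟨rfl, rfl⟩, rfl, rfl,
      F.link hw hu huw.symm hpw hpu (fun _ _ => rfl) hlt (Or.inl rfl),
      Forest.charge_le_charge_link hw huw.symm hpw hpu (fun _ _ => rfl) le_rfl,
      Forest.numRoots_link hw huw.symm hpw, ?_, ?_, by simp⟩
    · intro r hr
      simp [hreg r hr]
    · intro f h4 h5
      simp [h4]
  · have hrk : ∀ x, x ≠ w₀ →
        Function.update (m.fld 5) w₀ (m.fld 5 w₀ + 1) x = m.fld 5 x :=
      fun x hx => by simp [hx]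
    refine ⟨u₀, w₀, _, Or.inl ⟨rfl, rfl⟩, rfl, rfl,
      F.link hu hw huw hpu hpw hrk ?_ (Or.inr ⟨by simp, by omega⟩),
      Forest.charge_le_charge_link hu huw hpu hpw hrk (by simp),
      Forest.numRoots_link hu huw hpu, ?_, ?_, by simp⟩
    · rw [Function.update_self]
      omega
    · intro r hr
      simp [hreg r hr]
    · intro f h4 h5
      simp [h4, h5]

/-- Move the half-edges at the vertex in the variable 13 to the vertex in the variable 20. -/
def moveHalfEdges (K : ℕ) : Prog :=
  unroll (fun k => .seq (.prim (.load 21 (k + 10) 13))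
    (.ite (.eq 21 0) (.prim .skip) (putHalfEdge k))) K

/-- Only the entries at `w` are written, so those of `u ≠ w` are read unchanged throughout. A
half-edge justifying an entry at `u` also justifies it at `w`, as `c u = c w`. -/
theorem run_moveHalfEdges {α : Type} {V K u w : ℕ} {H O : ℕ → ℕ → ℕ → Prop} {c : ℕ → α}
    {rt : ℕ → ℕ} {m : Mem} (hm : m.HasTables V K H c rt O) (hc : HalfClosed H c)
    (h0 : m.reg 0 = V) (hru : m.reg 13 = u) (hrw : m.reg 20 = w) (hu : u < V) (hw : w < V)
    (huw : u ≠ w) (hcuw : c u = c w) :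
    Run (moveHalfEdges K) m fun t m' =>
      m'.HasTables V K H c rt (fun x k y => O x k y ∨
        (x = w ∧ k < K ∧ m.fld (k + 10) u ≠ V ∧ y = m.fld (k + 10) u)) ∧
      (∀ k, m'.fld (k + 10) u = m.fld (k + 10) u) ∧
      (∀ r < 20, r ≠ 5 → m'.reg r = m.reg r) ∧ m'.reg 5 ≤ m.reg 5 + K ∧
      m'.fld 4 = m.fld 4 ∧ m'.fld 5 = m.fld 5 ∧ t ≤ 7 * K + 1 := by
  refine (run_unroll (fun k τ m₁ =>
    m₁.HasTables V K H c rt (fun x j y => O x j y ∨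
      (x = w ∧ j < k ∧ m.fld (j + 10) u ≠ V ∧ y = m.fld (j + 10) u)) ∧
    (∀ j, m₁.fld (j + 10) u = m.fld (j + 10) u) ∧
    (∀ r < 21, r ≠ 5 → m₁.reg r = m.reg r) ∧ m₁.reg 5 ≤ m.reg 5 + k ∧
    m₁.fld 4 = m.fld 4 ∧ m₁.fld 5 = m.fld 5 ∧ τ ≤ 7 * k) ?_ (τ := 0) ?_).mono ?_
  · rintro k hk τ m₁ ⟨hT, hTu, hreg, h5, hf4, hf5, hτ⟩
    have r13 : m₁.reg 13 = u := by rw [hreg 13 (by simp) (by simp), hru]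
    have r20 : m₁.reg 20 = w := by rw [hreg 20 (by simp) (by simp), hrw]
    have r0 : m₁.reg 0 = V := by rw [hreg 0 (by simp) (by simp), h0]
    simp only [run_seq, run_ite, run_prim, Prim.run, Test.Holds, Function.update_self,
      ne_eq, OfNat.zero_ne_ofNat, not_false_eq_true, Function.update_of_ne, r13, r0, hTu]
    constructor
    · intro hV
      refine ⟨?_, fun _ => trivial, ?_, ?_, hf4, hf5, by omega⟩
      · have : m₁.HasTables V K H c rt (fun x j y => O x j y ∨
            (x = w ∧ j < k + 1 ∧ m.fld (j + 10) u ≠ V ∧ y = m.fld (j + 10) u)) := by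
          refine hT.congr_obligations ?_
          rintro x j y (h | ⟨rfl, hj, hne, rfl⟩)
          · exact Or.inl h
          · have : j ≠ k := by rintro rfl; exact hne hV
            exact Or.inr ⟨rfl, by omega, hne, rfl⟩
        simpa [Mem.HasTables] using this
      · intro r hr h5
        rw [Function.update_of_ne (by omega), hreg r hr h5]
      · simpa using h5.trans (by omega)
    · intro hV
      have hle := hT.T_le k hk u hu
      simp only [hTu] at hle
      refine (run_putHalfEdge (V := V) (K := K) (rt := rt) (H := H) (c := c)
        (O := fun x j y => O x j y ∨
          (x = w ∧ j < k ∧ m.fld (j + 10) u ≠ V ∧ y = m.fld (j + 10) u))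
        ?_ hc hk ?_ ?_ ?_ ?_).mono ?_
      · simpa [Mem.HasTables] using hT
      · simpa using r0
      · simpa [r20] using hw
      · simpa using lt_of_le_of_ne hle hV
      · obtain ⟨a, b, h1, h2, h3⟩ := hT.T_sound k hk u hu (by simpa [hTu] using hV)
        refine ⟨a, b, h1, ?_, ?_⟩
        · simpa [r20, ← hcuw] using h2
        · simpa [hTu] using h3
      · rintro t m₂ ⟨hT₂, hreg₂, h5₂, hf₂, hTu₂, ht⟩
        simp only [ne_eq, Nat.reduceEqDiff, not_false_eq_true, Function.update_of_ne,
          Function.update_self, r20] at hT₂ h5₂ hTu₂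
        refine ⟨?_, ?_, ?_, by omega, ?_, ?_, by omega⟩
        · refine hT₂.congr_obligations ?_
          rintro x j y (h | ⟨rfl, hj, hne, rfl⟩)
          · exact Or.inl (Or.inl h)
          · rcases eq_or_ne j k with rfl | hjk
            · exact Or.inr ⟨rfl, rfl, rfl⟩
            · exact Or.inl (Or.inr ⟨rfl, by omega, hne, rfl⟩)
        · intro j
          rw [hTu₂ j u huw, hTu]
        · intro r hr h5
          rw [hreg₂ r (by omega) h5]
          simp [show r ≠ 21 by omega, hreg r hr h5]
        · rw [hf₂ 4 (by simp) (by simp) (by simp), hf4]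
        · rw [hf₂ 5 (by simp) (by simp) (by simp), hf5]
  · refine ⟨hm.congr_obligations ?_, by simp, by simp, by simp, rfl, rfl, by simp⟩
    rintro x k y (h | ⟨-, hk, -⟩)
    · exact h
    · omega
  · rintro t m' ⟨τ', ⟨hT, hTu, hreg, h5, hf4, hf5, hτ⟩, ht⟩
    exact ⟨hT, hTu, fun r hr => hreg r (by omega), h5, hf4, hf5, by omega⟩

/-- The forest and the tables describe a stage of the folding of the half-edges `H`. -/
structure Mem.Stage {α : Type} (m : Mem) (V K : ℕ) (H : ℕ → ℕ → ℕ → Prop) (c : ℕ → α)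
    (rt sz : ℕ → ℕ) : Prop where
  reg_zero : m.reg 0 = V
  forest : Forest V (m.fld 4) (m.fld 5) rt sz
  tables : m.HasTables V K H c rt fun x k b => ∃ a, H a k b ∧ x = rt a

/-- Take the first pair from the queue and identify its members. -/
def processPair (K : ℕ) : Prog :=
  .seq (.prim (.load 10 6 4)) (.seq (.prim (.load 14 7 4)) (.seq (.prim (.succ 4))
    (.seq findRoot (.seq (.prim (.copy 13 10)) (.seq (.prim (.copy 10 14)) (.seq findRoot
      (.ite (.eq 13 10) (.prim .skip) (.seq linkRoots (moveHalfEdges K)))))))))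

theorem run_processPair {α : Type} {V K : ℕ} {H : ℕ → ℕ → ℕ → Prop} {c : ℕ → α}
    {rt sz : ℕ → ℕ} {m : Mem} (hm : m.Stage V K H c rt sz) (hc : HalfClosed H c)
    (hH : ∀ a k b, H a k b → a < V ∧ k < K) (hlt : m.reg 4 < m.reg 5) :
    Run (processPair K) m fun t m' => (∃ rt' sz', m'.Stage V K H c rt' sz') ∧
      m'.reg 4 = m.reg 4 + 1 ∧
      m'.reg 5 + K * numRoots V (m'.fld 4) ≤ m.reg 5 + K * numRoots V (m.fld 4) ∧
      t + 5 * charge V (m.fld 4) (m.fld 5) ≤ 5 * charge V (m'.fld 4) (m'.fld 5) +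
        10 * logStar V + (7 * K + 30) := by
  obtain ⟨h0, F, hT⟩ := hm
  obtain ⟨ha, hb⟩ := hT.q_lt _ hlt
  have hcq := hT.c_q _ hlt
  simp only [processPair, run_seq, run_prim, Prim.run]
  refine Run.mono (run_findRoot (V := V) (rt := rt) (sz := sz) ?_ ?_) ?_
  · exact F
  · simpa using ha
  rintro t₁ m₁ ⟨⟨F₁, hreg₁, hfld₁, hnum₁, hch₁⟩, hx₁, ht₁⟩
  simp only [ne_eq, Nat.reduceEqDiff, not_false_eq_true, Function.update_of_ne,
    Function.update_self] at hx₁ hfld₁ hnum₁ hch₁ ht₁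
  have r14 : m₁.reg 14 = m.fld 7 (m.reg 4) := by rw [hreg₁ 14 (by simp) (by simp)]; simp
  refine Run.mono (run_findRoot (V := V) (rt := rt) (sz := sz) ?_ ?_) ?_
  · exact F₁
  · simpa [r14] using hb
  rintro t₂ m₂ ⟨⟨F₂, hreg₂, hfld₂, hnum₂, hch₂⟩, hx₂, ht₂⟩
  simp only [ne_eq, Nat.reduceEqDiff, not_false_eq_true, Function.update_of_ne,
    Function.update_self, r14, hx₁] at hx₂ hfld₂ hnum₂ hch₂ ht₂
  have r13 : m₂.reg 13 = rt (m.fld 6 (m.reg 4)) := by rw [hreg₂ 13 (by simp) (by simp)]; simp [hx₁]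
  have rlow : ∀ r < 10, r ≠ 4 → m₂.reg r = m.reg r := by
    intro r hr h4
    have h10 : r ≠ 10 := by omega
    have h11 : r ≠ 11 := by omega
    rw [hreg₂ r h10 h11]
    simp [h10, show r ≠ 13 by omega, show r ≠ 14 by omega, h4, hreg₁ r h10 h11]
  have r4 : m₂.reg 4 = m.reg 4 + 1 := by
    rw [hreg₂ 4 (by simp) (by simp)]
    simp [hreg₁ 4]
  have r5 := rlow 5 (by simp) (by simp)
  have hfld : ∀ f, f ≠ 4 → m₂.fld f = m.fld f := fun f hf => (hfld₂ f hf).trans (hfld₁ f hf)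
  have ha' := F.rt_lt _ ha
  have hb' := F.rt_lt _ hb
  have hpa := F₂.par_rt _ ha
  have hpb := F₂.par_rt _ hb
  have hca := hT.c_rt _ ha
  have hcb := hT.c_rt _ hb
  simp only [run_ite, Test.Holds, run_prim, run_seq, Prim.run, r13, hx₂]
  constructor
  · intro heq
    refine ⟨⟨rt, sz, (rlow 0 (by simp) (by simp)).trans h0, F₂, ?_⟩, r4, ?_, by omega⟩
    · have := Tables.pop hT hlt hT.c_rt fun f hf => ⟨hf, by rw [← hf _ ha, ← hf _ hb, heq]⟩
      simpa [Mem.HasTables, hfld, r4, r5] using this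
    · rw [r5, hnum₂, hnum₁]
  · intro hne
    refine (run_linkRoots F₂ r13 hx₂ ha' hb' hne hpa hpb).mono ?_
    rintro t₃ m₃ ⟨u, w, sz', huw, r13₃, r20₃, F₃, hch₃, hnum₃, hreg₃, hfld₃, ht₃⟩
    have huV : u < V := by rcases huw with ⟨rfl, -⟩ | ⟨rfl, -⟩ <;> assumption
    have hwV : w < V := by rcases huw with ⟨-, rfl⟩ | ⟨-, rfl⟩ <;> assumption
    have hne' : u ≠ w := by
      rcases huw with ⟨rfl, rfl⟩ | ⟨rfl, rfl⟩
      · exact hne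
      · exact Ne.symm hne
    have hcuw : c u = c w := by
      rcases huw with ⟨rfl, rfl⟩ | ⟨rfl, rfl⟩
      · rw [hca, hcb, hcq]
      · rw [hca, hcb, hcq]
    have hT₃ : m₃.HasTables V K H c (fun x => if rt x = u then w else rt x)
        fun x k b => ∃ a, H a k b ∧ x = rt a := by
      have := Tables.pop (rt' := fun x => if rt x = u then w else rt x) hT hlt (by
        intro v hv
        split_ifs with h
        · rw [← hcuw, ← h]
          exact hT.c_rt v hv
        · exact hT.c_rt v hv) (by
        intro f hf
        -- The child `u` was the root of one member of the pair, and its new root is `w`; hence a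
        -- function invariant under the new roots identifies `u` and `w`.
        have huw' : f u = f w := by
          rcases huw with ⟨rfl, rfl⟩ | ⟨rfl, rfl⟩
          · have := hf _ ha'
            rw [F.rt_rt ha, if_pos rfl] at this
            exact this.symm
          · have := hf _ hb'
            rw [F.rt_rt hb, if_pos rfl] at this
            exact this.symm
        have hf' : ∀ v < V, f (rt v) = f v := by
          intro v hv
          have := hf v hv
          split_ifs at this with h
          · rw [h, huw', this]
          · exact this
        refine ⟨hf', ?_⟩
        rw [← hf' _ ha, ← hf' _ hb]
        rcases huw with ⟨rfl, rfl⟩ | ⟨rfl, rfl⟩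
        · exact huw'
        · exact huw'.symm)
      have e : ∀ f, f ≠ 4 → f ≠ 5 → m₃.fld f = m.fld f :=
        fun f h4 h5 => (hfld₃ f h4 h5).trans (hfld f h4)
      simpa [Mem.HasTables, e, hreg₃, r4, r5] using this
    refine (run_moveHalfEdges hT₃ hc ((hreg₃ 0 (by simp)).trans
      ((rlow 0 (by simp) (by simp)).trans h0)) r13₃ r20₃ huV hwV hne' hcuw).mono ?_
    rintro t₄ m₄ ⟨hT₄, hTu, hreg₄, h5₄, hf4, hf5, ht₄⟩
    refine ⟨⟨_, sz', ?_, ?_, { hT₄ with complete := ?_ }⟩, ?_, ?_, ?_⟩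
    · rw [hreg₄ 0 (by simp) (by simp), hreg₃ 0 (by simp), rlow 0 (by simp) (by simp), h0]
    · rw [hf4, hf5]
      exact F₃
    -- If the root of `a` was the child `u`, the obligation at `w` follows in two steps: the target
    -- in the table of `u` represents `b`, and moving the half-edge made the entry at `w` represent
    -- that target.
    · rintro x k b ⟨a, hab, rfl⟩
      have h1 := hT₄.complete (rt a) k b (Or.inl ⟨a, hab, rfl⟩)
      split_ifs with h
      · rw [h] at h1
        simp only [hTu] at h1
        have h2 := hT₄.complete w k _ (Or.inr ⟨rfl, (hH a k b hab).2, h1.1, rfl⟩)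
        exact ⟨h2.1, fun f hf hq => (h2.2 f hf hq).trans (h1.2 f hf hq)⟩
      · exact h1
    · rw [hreg₄ 4 (by simp) (by simp), hreg₃ 4 (by simp), r4]
    -- The link destroys a root, and this pays for the at most `K` pairs appended to the queue.
    · have e5 : m₃.reg 5 = m.reg 5 := (hreg₃ 5 (by simp)).trans r5
      have := Nat.mul_le_mul_left K hnum₃
      rw [mul_add, hnum₂, hnum₁] at this
      rw [hf4]
      omega
    · rw [hf4, hf5]
      omega

/-- Process the queue until it is empty. -/
def processQueue (K : ℕ) : Prog := .loop (.lt 4 5) (processPair K)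

theorem run_processQueue {α : Type} {V K Q : ℕ} {H : ℕ → ℕ → ℕ → Prop} {c : ℕ → α}
    {rt sz : ℕ → ℕ} {m : Mem} (hm : m.Stage V K H c rt sz) (hc : HalfClosed H c)
    (hH : ∀ a k b, H a k b → a < V ∧ k < K) (hQ : m.reg 5 ≤ m.reg 4 + Q) :
    Run (processQueue K) m fun t m' => (∃ rt' sz', m'.Stage V K H c rt' sz') ∧
      m'.reg 4 = m'.reg 5 ∧
      t ≤ 5 * charge V (m'.fld 4) (m'.fld 5) +
        (Q + K * V) * (10 * logStar V + (7 * K + 31)) + 1 := by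
  set D := 10 * logStar V + (7 * K + 31) with hD
  -- Here `k` bounds the number of pairs still to be processed: the pending ones, plus `K` for each
  -- remaining root. It starts at no more than `Q + K * V`, and each pair costs `D` apart from the
  -- charge.
  refine (run_loop (fun k τ m₁ => (∃ rt' sz', m₁.Stage V K H c rt' sz') ∧
    m₁.reg 5 + K * numRoots V (m₁.fld 4) = m₁.reg 4 + k ∧
    τ + k * D ≤ 5 * charge V (m₁.fld 4) (m₁.fld 5) + (Q + K * V) * D)
    ?_ (τ := 0) (k := m.reg 5 + K * numRoots V (m.fld 4) - m.reg 4) ?_).mono ?_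
  · rintro k τ m₁ ⟨⟨rt', sz', h⟩, hk, hτ⟩ hb
    have hb' : m₁.reg 4 < m₁.reg 5 := hb
    refine (run_processPair h hc hH hb').mono ?_
    rintro t m₂ ⟨⟨rt'', sz'', h₂⟩, h4, h5, ht⟩
    have hle : m₂.reg 4 ≤ m₂.reg 5 := h₂.tables.hd_le
    refine ⟨m₂.reg 5 + K * numRoots V (m₂.fld 4) - m₂.reg 4, by omega, ⟨_, _, h₂⟩, by omega, ?_⟩
    have hk' : m₂.reg 5 + K * numRoots V (m₂.fld 4) - m₂.reg 4 + 1 ≤ k := by omega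
    have := Nat.mul_le_mul_right D hk'
    rw [add_mul] at this
    omega
  · have hle : m.reg 4 ≤ m.reg 5 := hm.tables.hd_le
    refine ⟨⟨_, _, hm⟩, by omega, ?_⟩
    have h1 := Nat.mul_le_mul_left K (numRoots_le V (m.fld 4))
    have h2 : m.reg 5 + K * numRoots V (m.fld 4) - m.reg 4 ≤ Q + K * V := by omega
    have := Nat.mul_le_mul_right D h2
    omega
  · rintro t m' ⟨k, τ, ⟨⟨rt', sz', h⟩, hk, hτ⟩, hb, ht⟩
    have hb' : ¬ m'.reg 4 < m'.reg 5 := hb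
    have hle : m'.reg 4 ≤ m'.reg 5 := h.tables.hd_le
    exact ⟨⟨_, _, h⟩, by omega, by omega⟩

/-! ### Writing the folded graph -/

/-- Number the roots consecutively in the function 8; their number is left in the variable 6. -/
def numberRoots : Prog :=
  .seq (.prim (.const 3 0)) (.seq (.prim (.const 6 0)) (.loop (.lt 3 0)
    (.seq (.prim (.load 11 4 3)) (.seq (.ite (.eq 11 3)
      (.seq (.prim (.store 8 3 6)) (.prim (.succ 6))) (.prim .skip)) (.prim (.succ 3))))))

/-- `idx` numbers the fixed points of `par` among `0, …, N - 1` by `0, …, s - 1`. -/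
structure NumbersRoots (N : ℕ) (par idx : ℕ → ℕ) (s : ℕ) : Prop where
  lt : ∀ v < N, par v = v → idx v < s
  inj : ∀ v < N, ∀ w < N, par v = v → par w = w → idx v = idx w → v = w
  surj : ∀ i < s, ∃ v < N, par v = v ∧ idx v = i

theorem run_numberRoots {V : ℕ} {m : Mem} (h0 : m.reg 0 = V) :
    Run numberRoots m fun t m' => NumbersRoots V (m.fld 4) (m'.fld 8) (m'.reg 6) ∧
      m'.reg 0 = V ∧ (∀ f, f ≠ 8 → m'.fld f = m.fld f) ∧ t ≤ 6 * V + 3 := by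
  simp only [numberRoots, run_seq, run_prim, Prim.run]
  refine (run_for (N := V) (fun j τ m₁ => j ≤ V ∧ m₁.reg 0 = V ∧ m₁.reg 3 = j ∧
    NumbersRoots j (m.fld 4) (m₁.fld 8) (m₁.reg 6) ∧
    (∀ f, f ≠ 8 → m₁.fld f = m.fld f) ∧ τ ≤ 6 * j) ?_ ?_ (τ := 0) ?_).mono ?_
  · rintro j τ m₁ ⟨hj, h0, h3, -⟩
    exact ⟨hj, h3, h0⟩
  · rintro j hj τ m₁ ⟨-, h0, h3, hN, hf, hτ⟩
    simp only [run_seq, run_ite, run_prim, Prim.run, Test.Holds, h3, hf 4 (by simp), ne_eq,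
      Nat.reduceEqDiff, not_false_eq_true, Function.update_of_ne, Function.update_self,
      OfNat.zero_ne_ofNat, h0]
    constructor
    · intro hroot
      refine ⟨hj, trivial, trivial, ⟨?_, ?_, ?_⟩, ?_, by omega⟩
      · intro v hv hpv
        rcases eq_or_ne v j with rfl | hne
        · simp
        · have := hN.lt v (by omega) hpv
          simp only [Function.update_of_ne hne]
          omega
      · intro v hv w hw hpv hpw
        rcases eq_or_ne v j with hvj | hvj <;> rcases eq_or_ne w j with hwj | hwj
        · exact fun _ => hvj.trans hwj.symm
        · have := hN.lt w (by omega) hpw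
          rw [hvj, Function.update_self, Function.update_of_ne hwj]
          omega
        · have := hN.lt v (by omega) hpv
          rw [hwj, Function.update_self, Function.update_of_ne hvj]
          omega
        · simpa [hvj, hwj] using hN.inj v (by omega) w (by omega) hpv hpw
      · intro i hi
        rcases eq_or_ne i (m₁.reg 6) with rfl | hne
        · exact ⟨j, by omega, hroot, by simp⟩
        · obtain ⟨v, hv, hpv, hiv⟩ := hN.surj i (by omega)
          exact ⟨v, by omega, hpv, by simp [hv.ne, hiv]⟩
      · intro f h8
        simp [h8, hf f h8]
    · intro hroot
      refine ⟨hj, trivial, trivial, ⟨?_, ?_, ?_⟩, hf, by omega⟩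
      · intro v hv hpv
        have : v ≠ j := by rintro rfl; exact hroot hpv
        exact hN.lt v (by omega) hpv
      · intro v hv w hw hpv hpw
        have : v ≠ j := by rintro rfl; exact hroot hpv
        have : w ≠ j := by rintro rfl; exact hroot hpw
        exact hN.inj v (by omega) w (by omega) hpv hpw
      · intro i hi
        obtain ⟨v, hv, h⟩ := hN.surj i hi
        exact ⟨v, by omega, h⟩
  · exact ⟨Nat.zero_le _, by simpa using h0, by simp, ⟨by simp, by simp, by simp⟩, by simp, by simp⟩
  · rintro t m' ⟨τ', ⟨-, h0, -, hN, hf, hτ⟩, ht⟩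
    exact ⟨hN, h0, hf, by omega⟩

/-- Write the vertex map of the folding into the function 3. -/
def writeMap : Prog :=
  .seq (.prim (.const 3 0)) (.loop (.lt 3 0) (.seq (.prim (.copy 10 3)) (.seq findRoot
    (.seq (.prim (.load 11 8 10)) (.seq (.prim (.store 3 3 11)) (.prim (.succ 3)))))))

theorem run_writeMap {V : ℕ} {rt sz : ℕ → ℕ} {m : Mem} (h0 : m.reg 0 = V)
    (F : Forest V (m.fld 4) (m.fld 5) rt sz) :
    Run writeMap m fun t m' => (∀ v < V, m'.fld 3 v = m.fld 8 (rt v)) ∧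
      Forest V (m'.fld 4) (m'.fld 5) rt sz ∧ m'.reg 0 = V ∧ m'.reg 6 = m.reg 6 ∧
      (∀ f, f ≠ 3 → f ≠ 4 → m'.fld f = m.fld f) ∧
      t + 5 * charge V (m.fld 4) (m.fld 5) ≤ 5 * charge V (m'.fld 4) (m'.fld 5) +
        V * (5 * logStar V + 12) + 2 := by
  simp only [writeMap, run_seq, run_prim, Prim.run]
  refine (run_for (N := V) (fun j τ m₁ => j ≤ V ∧ m₁.reg 0 = V ∧ m₁.reg 3 = j ∧
    (∀ v < j, m₁.fld 3 v = m.fld 8 (rt v)) ∧ Forest V (m₁.fld 4) (m₁.fld 5) rt sz ∧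
    m₁.reg 6 = m.reg 6 ∧ (∀ f, f ≠ 3 → f ≠ 4 → m₁.fld f = m.fld f) ∧
    τ + 5 * charge V (m.fld 4) (m.fld 5) ≤ 5 * charge V (m₁.fld 4) (m₁.fld 5) +
      j * (5 * logStar V + 12)) ?_ ?_ (τ := 0) ?_).mono ?_
  · rintro j τ m₁ ⟨hj, h0, h3, -⟩
    exact ⟨hj, h3, h0⟩
  · rintro j hj τ m₁ ⟨-, h0, h3, hv, F₁, h6, hf, hτ⟩
    simp only [run_seq, run_prim, Prim.run]
    refine Run.mono (run_findRoot (V := V) (rt := rt) (sz := sz) ?_ ?_) ?_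
    · exact F₁
    · simpa [h3] using hj
    rintro t m₂ ⟨⟨F₂, hreg, hfld, -, -⟩, hx, ht⟩
    simp only [Function.update_self, h3] at hx ht hfld
    have r3 : m₂.reg 3 = j := by rw [hreg 3 (by simp) (by simp)]; simpa using h3
    have r0 : m₂.reg 0 = V := by rw [hreg 0 (by simp) (by simp)]; simpa using h0
    have r6 : m₂.reg 6 = m.reg 6 := by rw [hreg 6 (by simp) (by simp)]; simpa using h6
    simp only [ne_eq, Nat.reduceEqDiff, not_false_eq_true, Function.update_of_ne,
      Function.update_self, OfNat.zero_ne_ofNat, r3, r0, r6, hx, hfld 8 (by simp),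
      hfld 3 (by simp), hf 8 (by simp) (by simp)]
    refine ⟨hj, trivial, trivial, ?_, F₂, trivial, ?_, ?_⟩
    · intro v hv'
      rcases eq_or_ne v j with rfl | hne
      · simp
      · simp [hne, hv v (by omega)]
    · intro f h3 h4
      simp [h3, hfld f h4, hf f h3 h4]
    · rw [add_mul]
      omega
  · exact ⟨Nat.zero_le _, by simpa using h0, by simp, by simp, F, by simp, by simp, by simp⟩
  · rintro t m' ⟨τ', ⟨-, h0, -, hv, F', h6, hf, hτ⟩, ht⟩
    exact ⟨hv, F', h0, h6, hf, by omega⟩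

/-- The first `s` values of `A`, `B`, `L` list the triples `(idx v, tgt v k, k)` with `P v k`. -/
structure Lists (idx : ℕ → ℕ) (tgt : ℕ → ℕ → ℕ) (P : ℕ → ℕ → Prop) (A B L : ℕ → ℕ) (s : ℕ) :
    Prop where
  sound : ∀ i < s, ∃ v k, P v k ∧ A i = idx v ∧ B i = tgt v k ∧ L i = k
  complete : ∀ v k, P v k → ∃ i < s, A i = idx v ∧ B i = tgt v k ∧ L i = k
  inj : ∀ i < s, ∀ j < s, A i = A j → L i = L j → i = j

theorem Lists.congr {idx : ℕ → ℕ} {tgt : ℕ → ℕ → ℕ} {P P' : ℕ → ℕ → Prop} {A B L : ℕ → ℕ}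
    {s : ℕ} (h : Lists idx tgt P A B L s) (hP : ∀ v k, P' v k ↔ P v k) :
    Lists idx tgt P' A B L s := by
  obtain rfl : P' = P := by
    ext v k
    exact hP v k
  exact h

theorem Lists.snoc {idx : ℕ → ℕ} {tgt : ℕ → ℕ → ℕ} {P P' : ℕ → ℕ → Prop} {A B L : ℕ → ℕ}
    {s v k : ℕ} (h : Lists idx tgt P A B L s) (hnew : ∀ w, P w k → idx w ≠ idx v)
    (hP : ∀ w j, P' w j ↔ P w j ∨ (w = v ∧ j = k)) :
    Lists idx tgt P' (Function.update A s (idx v)) (Function.update B s (tgt v k))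
      (Function.update L s k) (s + 1) := by
  refine ⟨?_, ?_, ?_⟩
  · intro i hi
    rcases eq_or_ne i s with rfl | hne
    · exact ⟨v, k, (hP v k).2 (Or.inr ⟨rfl, rfl⟩), by simp⟩
    · obtain ⟨w, j, hw, h'⟩ := h.sound i (by omega)
      exact ⟨w, j, (hP w j).2 (Or.inl hw), by simpa [hne] using h'⟩
  · intro w j hw
    rcases (hP w j).1 hw with hw | ⟨rfl, rfl⟩
    · obtain ⟨i, hi, h'⟩ := h.complete w j hw
      exact ⟨i, by omega, by simpa [hi.ne] using h'⟩
    · exact ⟨s, by omega, by simp⟩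
  · have key : ∀ i < s, ¬ (A i = idx v ∧ L i = k) := by
      rintro i hi ⟨hA, hL⟩
      obtain ⟨w, j, hw, h1, -, h3⟩ := h.sound i hi
      obtain rfl : j = k := h3.symm.trans hL
      exact hnew w hw (h1.symm.trans hA)
    intro i hi j hj
    rcases eq_or_ne i s with his | his <;> rcases eq_or_ne j s with hjs | hjs
    · exact fun _ _ => his.trans hjs.symm
    · simp only [his, Function.update_self, Function.update_of_ne hjs]
      exact fun h1 h2 => absurd ⟨h1.symm, h2.symm⟩ (key j (by omega))
    · simp only [hjs, Function.update_self, Function.update_of_ne his]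
      exact fun h1 h2 => absurd ⟨h1, h2⟩ (key i (by omega))
    · simpa [his, hjs] using h.inj i (by omega) j (by omega)

/-- Write the edges of the folded graph: one for each entry of type less than `n` in the tables of
the roots. Their number is left in the variable 7. -/
def writeEdges (n : ℕ) : Prog :=
  .seq (.prim (.const 3 0)) (.seq (.prim (.const 7 0)) (.loop (.lt 3 0)
    (.seq (.prim (.load 11 4 3)) (.seq (.ite (.eq 11 3)
      (unroll (fun k => .seq (.prim (.load 21 (k + 10) 3)) (.ite (.eq 21 0) (.prim .skip)
        (.seq (.prim (.load 20 8 3)) (.seq (.prim (.store 0 7 20))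
          (.seq (.prim (.load 20 3 21)) (.seq (.prim (.store 1 7 20))
            (.seq (.prim (.const 20 k)) (.seq (.prim (.store 2 7 20)) (.prim (.succ 7)))))))))) n)
      (.prim .skip)) (.prim (.succ 3))))))

/-- Overwriting the input edges in the functions 0, 1, 2 is harmless, since the tables of the roots
retain all that is needed. Types below `n` suffice, because the others list the same edges from
their terminal vertices. -/
theorem run_writeEdges {n V s : ℕ} {m : Mem} (h0 : m.reg 0 = V)
    (hN : NumbersRoots V (m.fld 4) (m.fld 8) s) :
    Run (writeEdges n) m fun t m' =>
      Lists (m.fld 8) (fun v k => m.fld 3 (m.fld (k + 10) v))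
        (fun v k => (v < V ∧ m.fld 4 v = v ∧ m.fld (k + 10) v ≠ V) ∧ k < n)
        (m'.fld 0) (m'.fld 1) (m'.fld 2) (m'.reg 7) ∧
      m'.fld 3 = m.fld 3 ∧ m'.reg 6 = m.reg 6 ∧ t ≤ (9 * n + 6) * V + 3 := by
  simp only [writeEdges, run_seq, run_prim, Prim.run]
  refine (run_for (N := V) (fun j τ m₁ => j ≤ V ∧ m₁.reg 0 = V ∧ m₁.reg 3 = j ∧
    Lists (m.fld 8) (fun v k => m.fld 3 (m.fld (k + 10) v))
      (fun v k => (v < j ∧ m.fld 4 v = v ∧ m.fld (k + 10) v ≠ V) ∧ k < n)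
      (m₁.fld 0) (m₁.fld 1) (m₁.fld 2) (m₁.reg 7) ∧
    (∀ f, 3 ≤ f → m₁.fld f = m.fld f) ∧ m₁.reg 6 = m.reg 6 ∧ τ ≤ (9 * n + 6) * j)
    ?_ ?_ (τ := 0) ?_).mono ?_
  · rintro j τ m₁ ⟨hj, h0, h3, -⟩
    exact ⟨hj, h3, h0⟩
  · rintro j hj τ m₁ ⟨-, h0, h3, hL, hf, h6, hτ⟩
    simp only [run_seq, run_ite, run_prim, Prim.run, Test.Holds, h3, hf 4 (by simp), ne_eq,
      Nat.reduceEqDiff, not_false_eq_true, Function.update_of_ne, Function.update_self]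
    constructor
    · intro hroot
      refine (run_unroll (fun k τ' m₂ => m₂.reg 0 = V ∧ m₂.reg 3 = j ∧
        Lists (m.fld 8) (fun v k => m.fld 3 (m.fld (k + 10) v))
          (fun v i => ((v < j ∧ m.fld 4 v = v ∧ m.fld (i + 10) v ≠ V) ∧ i < n) ∨
            (v = j ∧ i < k ∧ m.fld (i + 10) v ≠ V))
          (m₂.fld 0) (m₂.fld 1) (m₂.fld 2) (m₂.reg 7) ∧
        (∀ f, 3 ≤ f → m₂.fld f = m.fld f) ∧ m₂.reg 6 = m.reg 6 ∧ τ' ≤ 9 * k)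
        ?_ (τ := 0) ?_).mono ?_
      · rintro k hk τ' m₂ ⟨h0₂, h3₂, hL₂, hf₂, h6₂, hτ₂⟩
        have e3 := hf₂ 3 (by simp)
        have e8 := hf₂ 8 (by simp)
        have ek := hf₂ (k + 10) (by omega)
        simp only [run_seq, run_ite, run_prim, Prim.run, Test.Holds, h3₂, h0₂, ek, e8, e3, ne_eq,
          Nat.reduceEqDiff, not_false_eq_true, Function.update_of_ne, Function.update_self,
          OfNat.zero_ne_ofNat, OfNat.ofNat_ne_zero, OfNat.ofNat_ne_one, one_ne_zero, zero_ne_one,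
          OfNat.one_ne_ofNat]
        constructor
        · intro hV
          refine ⟨trivial, trivial, ?_, hf₂, h6₂, by omega⟩
          refine hL₂.congr fun v i => or_congr_right ⟨?_, ?_⟩
          · rintro ⟨rfl, hi, hne⟩
            have : i ≠ k := by rintro rfl; exact hne hV
            exact ⟨rfl, by omega, hne⟩
          · rintro ⟨rfl, hi, hne⟩
            exact ⟨rfl, by omega, hne⟩
        · intro hV
          refine ⟨trivial, trivial, ?_, ?_, h6₂, by omega⟩
          · refine hL₂.snoc (v := j) (k := k) ?_ ?_
            · rintro w (⟨⟨hw, hpw, -⟩, -⟩ | ⟨-, h, -⟩)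
              · intro he
                have := hN.inj w (by omega) j hj hpw hroot he
                omega
              · omega
            · intro w i
              constructor
              · rintro (h | ⟨rfl, hi, hne⟩)
                · exact Or.inl (Or.inl h)
                · rcases eq_or_ne i k with rfl | hik
                  · exact Or.inr ⟨rfl, rfl⟩
                  · exact Or.inl (Or.inr ⟨rfl, by omega, hne⟩)
              · rintro ((h | ⟨rfl, hi, hne⟩) | ⟨rfl, rfl⟩)
                · exact Or.inl h
                · exact Or.inr ⟨rfl, by omega, hne⟩
                · exact Or.inr ⟨rfl, by omega, hV⟩
          · intro f h3
            simp [show f ≠ 0 by omega, show f ≠ 1 by omega, show f ≠ 2 by omega, hf₂ f h3]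
      · refine ⟨by simpa using h0, by simpa using h3, ?_, hf, by simpa using h6, by simp⟩
        simpa using hL
      · rintro t m₂ ⟨τ', ⟨h0₂, h3₂, hL₂, hf₂, h6₂, hτ₂⟩, ht⟩
        simp only [h0₂, h3₂, h6₂]
        refine ⟨hj, trivial, trivial, ?_, hf₂, trivial, ?_⟩
        · refine hL₂.congr fun v k => ⟨?_, ?_⟩
          · rintro ⟨⟨hv, hpv, hne⟩, hk⟩
            rcases eq_or_ne v j with rfl | hvj
            · exact Or.inr ⟨rfl, hk, hne⟩
            · exact Or.inl ⟨⟨by omega, hpv, hne⟩, hk⟩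
          · rintro (⟨⟨hv, hpv, hne⟩, hk⟩ | ⟨rfl, hk, hne⟩)
            · exact ⟨⟨by omega, hpv, hne⟩, hk⟩
            · exact ⟨⟨by omega, hroot, hne⟩, hk⟩
        · rw [mul_add]
          omega
    · intro hroot
      simp only [h0, h6]
      refine ⟨hj, trivial, trivial, ?_, hf, trivial, ?_⟩
      · refine hL.congr fun v k => ?_
        constructor
        · rintro ⟨⟨hv, hpv, hne⟩, hk⟩
          have : v ≠ j := by rintro rfl; exact hroot hpv
          exact ⟨⟨by omega, hpv, hne⟩, hk⟩
        · rintro ⟨⟨hv, hpv, hne⟩, hk⟩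
          exact ⟨⟨by omega, hpv, hne⟩, hk⟩
      · rw [mul_add]
        omega
  · exact ⟨Nat.zero_le _, by simpa using h0, by simp, ⟨by simp, by simp, by simp⟩, by simp,
      by simp, by simp⟩
  · rintro t m' ⟨τ', ⟨-, -, -, hL, hf, h6, hτ⟩, ht⟩
    exact ⟨hL, hf 3 (by simp), h6, by omega⟩

/-! ### The folding algorithm -/

/-- Fold the graph in memory, whose labels are less than `n`. -/
def foldGraph (n : ℕ) : Prog :=
  .seq (setUp n) (.seq (enterEdges n) (.seq (processQueue (2 * n)) (.seq numberRoots
    (.seq writeMap (.seq (writeEdges n) (.seq (.prim (.copy 0 6)) (.prim (.copy 1 7))))))))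

/-- The constant in the running time of `foldGraph n`. -/
def foldGraphConst (n : ℕ) : ℕ := (2 * n + 2) * (14 * n + 41) + 13 * n + 100

theorem foldGraph_time_le {n V E L : ℕ} :
    (2 * n + 5) * V + 5 + ((2 * n + 18) * E + 2) +
      ((2 * E + 2 * n * V) * (10 * L + (7 * (2 * n) + 31)) + 1) + (6 * V + 3) +
      (5 * (2 * V * (L + 1)) + V * (5 * L + 12) + 2) + ((9 * n + 6) * V + 3) + 2 ≤
    foldGraphConst n * ((V + E + 1) * (L + 1)) := by
  have h1 : (2 * E + 2 * n * V) * (10 * L + (7 * (2 * n) + 31)) ≤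
      ((2 * n + 2) * (14 * n + 41)) * ((V + E + 1) * (L + 1)) := by
    calc _ ≤ ((2 * n + 2) * (V + E + 1)) * ((14 * n + 41) * (L + 1)) := by
          apply Nat.mul_le_mul <;> nlinarith [Nat.zero_le (n * E), Nat.zero_le (n * L)]
      _ = _ := by ring
  have h2 : (2 * n + 5) * V + 5 + ((2 * n + 18) * E + 2) + 1 + (6 * V + 3) +
      (5 * (2 * V * (L + 1)) + V * (5 * L + 12) + 2) + ((9 * n + 6) * V + 3) + 2 ≤
      (13 * n + 100) * ((V + E + 1) * (L + 1)) := by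
    calc _ ≤ ((2 * n + 5) * V + 5 + ((2 * n + 18) * E + 2) + 1 + (6 * V + 3) +
          (10 * V + V * 12 + 2) + ((9 * n + 6) * V + 3) + 2) * (L + 1) := by
            nlinarith [Nat.zero_le (n * V * L), Nat.zero_le (n * E * L), Nat.zero_le (V * L),
              Nat.zero_le (E * L)]
      _ ≤ ((13 * n + 100) * (V + E + 1)) * (L + 1) := by
            apply Nat.mul_le_mul_right
            nlinarith [Nat.zero_le (n * V), Nat.zero_le (n * E)]
      _ = _ := by ring
  have h3 : foldGraphConst n * ((V + E + 1) * (L + 1)) =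
      ((2 * n + 2) * (14 * n + 41)) * ((V + E + 1) * (L + 1)) +
        (13 * n + 100) * ((V + E + 1) * (L + 1)) := by
    rw [foldGraphConst]
    ring
  omega

theorem halfEdge_of_lt {n E a k b : ℕ} {ini ter lab : ℕ → ℕ}
    (h : halfEdge n ini ter lab E a k b) (hk : k < n) :
    ∃ e < E, a = ini e ∧ k = lab e ∧ b = ter e := by
  obtain ⟨e, he, h | h⟩ := h
  · exact ⟨e, he, h⟩
  · omega

theorem run_foldGraph {α : Type} {n V E : ℕ} {ini ter lab : ℕ → ℕ} {c : ℕ → α} {m : Mem}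
    (hini : ∀ e < E, ini e < V) (hter : ∀ e < E, ter e < V) (hlab : ∀ e < E, lab e < n)
    (hc : HalfClosed (halfEdge n ini ter lab E) c)
    (hmin : ∀ f : ℕ → ℕ, HalfClosed (halfEdge n ini ter lab E) f →
      ∀ u < V, ∀ v < V, c u = c v → f u = f v)
    (h0 : m.reg 0 = V) (h1 : m.reg 1 = E)
    (hf0 : m.fld 0 = ini) (hf1 : m.fld 1 = ter) (hf2 : m.fld 2 = lab) :
    Run (foldGraph n) m fun t m' =>
      t ≤ foldGraphConst n * ((V + E + 1) * (logStar V + 1)) ∧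
      (∀ v < V, m'.fld 3 v < m'.reg 0) ∧ (∀ i < m'.reg 0, ∃ v < V, m'.fld 3 v = i) ∧
      (∀ u < V, ∀ v < V, m'.fld 3 u = m'.fld 3 v ↔ c u = c v) ∧
      (∀ i < m'.reg 1, ∃ e < E, m'.fld 0 i = m'.fld 3 (ini e) ∧
        m'.fld 1 i = m'.fld 3 (ter e) ∧ m'.fld 2 i = lab e) ∧
      (∀ e < E, ∃ i < m'.reg 1, m'.fld 0 i = m'.fld 3 (ini e) ∧
        m'.fld 1 i = m'.fld 3 (ter e) ∧ m'.fld 2 i = lab e) ∧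
      (∀ i < m'.reg 1, ∀ j < m'.reg 1, m'.fld 0 i = m'.fld 0 j → m'.fld 2 i = m'.fld 2 j →
        i = j) := by
  have hH : ∀ a k b, halfEdge n ini ter lab E a k b → a < V ∧ k < 2 * n := by
    rintro a k b ⟨e, he, ⟨rfl, rfl, rfl⟩ | ⟨rfl, rfl, rfl⟩⟩
    · exact ⟨hini e he, by have := hlab e he; omega⟩
    · exact ⟨hter e he, by have := hlab e he; omega⟩
  simp only [foldGraph, run_seq]
  refine (run_setUp n m).mono ?_
  rintro t₁ m₁ ⟨hp₁, hr₁, hT₁, r0₁, r1₁, r4₁, r5₁, hf₁, ht₁⟩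
  rw [h0] at hp₁ hr₁ hT₁ r0₁ ht₁
  have hTab : m₁.HasTables V (2 * n) (halfEdge n ini ter lab E) c (fun x => x)
      fun _ _ _ => False := by
    refine ⟨fun k hk v hv => (hT₁ k hk v hv).le, ?_, ?_, fun _ _ => rfl, ?_, ?_, ?_⟩
    · intro i hi
      omega
    · omega
    · intro i hi
      omega
    · exact fun k hk v hv h => absurd (hT₁ k hk v hv) h
    · exact fun _ _ _ h => h.elim
  refine (run_enterEdges hini hter hlab hc hTab r0₁ (r1₁.trans h1) r5₁
    ((hf₁ 0 (by simp)).trans hf0) ((hf₁ 1 (by simp)).trans hf1)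
    ((hf₁ 2 (by simp)).trans hf2)).mono ?_
  rintro t₂ m₂ ⟨hT₂, r0₂, r5₂, hf4₂, hf5₂, ht₂⟩
  have F₂ : Forest V (m₂.fld 4) (m₂.fld 5) (fun x => x) (fun _ => 1) :=
    Forest.of_singletons (by rwa [hf4₂]) (by rwa [hf5₂])
  have hS₂ : m₂.Stage V (2 * n) (halfEdge n ini ter lab E) c (fun x => x) (fun _ => 1) := by
    refine ⟨r0₂, F₂, hT₂.congr_obligations ?_⟩
    rintro x k b ⟨a, h, rfl⟩
    exact h
  refine (run_processQueue hS₂ hc hH r5₂).mono ?_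
  rintro t₃ m₃ ⟨⟨rt, sz, r0₃, F₃, hT₃⟩, hq₃, ht₃⟩
  -- With no pending pairs left, `rt` itself is an admissible test function in the field `complete`.
  have hend : ∀ a k b, halfEdge n ini ter lab E a k b →
      m₃.fld (k + 10) (rt a) ≠ V ∧ rt (m₃.fld (k + 10) (rt a)) = rt b := by
    intro a k b h
    obtain ⟨h1, h2⟩ := hT₃.complete _ k b ⟨a, h, rfl⟩
    exact ⟨h1, h2 rt (fun v hv => F₃.rt_rt hv) fun i h1 h2 => by omega⟩
  have hrt : HalfClosed (halfEdge n ini ter lab E) rt := by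
    intro a k b a' b' h h' he
    rw [← (hend a k b h).2, ← (hend a' k b' h').2, he]
  -- Soundness of the identifications gives one direction, minimality of `c` applied to the
  -- compatible function `rt` the other.
  have hker : ∀ u < V, ∀ v < V, rt u = rt v ↔ c u = c v := by
    refine fun u hu v hv => ⟨fun h => ?_, hmin rt hrt u hu v hv⟩
    rw [← hT₃.c_rt u hu, ← hT₃.c_rt v hv, h]
  refine (run_numberRoots r0₃).mono ?_
  rintro t₄ m₄ ⟨hN₄, r0₄, hf₄, ht₄⟩
  have F₄ : Forest V (m₄.fld 4) (m₄.fld 5) rt sz := by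
    rwa [hf₄ 4 (by simp), hf₄ 5 (by simp)]
  refine (run_writeMap r0₄ F₄).mono ?_
  rintro t₅ m₅ ⟨hq₅, F₅, r0₅, r6₅, hf₅, ht₅⟩
  -- Path halving during `writeMap` changes parents, but both forests have the same root function
  -- `rt` and hence the same roots.
  have hroot : ∀ v < V, m₅.fld 4 v = v ↔ m₃.fld 4 v = v := by
    intro v hv
    refine ⟨fun h => ?_, fun h => ?_⟩
    · have := F₃.par_rt v hv
      rwa [F₅.rt_self v hv h] at this
    · have := F₅.par_rt v hv
      rwa [F₃.rt_self v hv h] at this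
  have hN₅ : NumbersRoots V (m₅.fld 4) (m₅.fld 8) (m₅.reg 6) := by
    rw [hf₅ 8 (by simp) (by simp), r6₅]
    refine ⟨fun v hv h => hN₄.lt v hv ((hroot v hv).1 h), fun v hv w hw h h' =>
      hN₄.inj v hv w hw ((hroot v hv).1 h) ((hroot w hw).1 h'), fun i hi => ?_⟩
    obtain ⟨v, hv, h, h'⟩ := hN₄.surj i hi
    exact ⟨v, hv, (hroot v hv).2 h, h'⟩
  refine (run_writeEdges r0₅ hN₅).mono ?_
  rintro t₆ m₆ ⟨hL, hf3₆, r6₆, ht₆⟩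
  have e8 : m₄.fld 8 = m₅.fld 8 := (hf₅ 8 (by simp) (by simp)).symm
  rw [e8] at hq₅
  have eT : ∀ k, m₅.fld (k + 10) = m₃.fld (k + 10) := fun k =>
    (hf₅ _ (by omega) (by omega)).trans (hf₄ _ (by omega))
  simp only [eT] at hL
  simp only [run_prim, Prim.run, Function.update_self, ne_eq, zero_ne_one, OfNat.ofNat_ne_zero,
    not_false_eq_true, Function.update_of_ne, r6₆, hf3₆]
  have hqker : ∀ u < V, ∀ v < V, m₅.fld 3 u = m₅.fld 3 v ↔ c u = c v := by
    intro u hu v hv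
    rw [← hker u hu v hv, hq₅ u hu, hq₅ v hv]
    exact ⟨hN₅.inj _ (F₅.rt_lt u hu) _ (F₅.rt_lt v hv) (F₅.par_rt u hu) (F₅.par_rt v hv),
      fun h => by rw [h]⟩
  have hTlt : ∀ k < n, ∀ v < V, m₃.fld (k + 10) v ≠ V → m₃.fld (k + 10) v < V :=
    fun k hk v hv h => lt_of_le_of_ne (hT₃.T_le k (by omega) v hv) h
  refine ⟨?_, ?_, ?_, hqker, ?_, ?_, ?_⟩
  -- The charge terms of the queue phase and of `writeMap` telescope, so a single bound on the final
  -- charge covers both.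
  · have hch := F₅.charge_le
    rw [hf₄ 4 (by simp), hf₄ 5 (by simp)] at ht₅
    refine le_trans ?_ foldGraph_time_le
    omega
  · intro v hv
    rw [hq₅ v hv]
    exact hN₅.lt _ (F₅.rt_lt v hv) (F₅.par_rt v hv)
  · intro i hi
    obtain ⟨v, hv, hpv, h⟩ := hN₅.surj i hi
    exact ⟨v, hv, by rw [hq₅ v hv, F₅.rt_self v hv hpv, h]⟩
  · intro i hi
    obtain ⟨v, k, ⟨⟨hv, hpv, hne⟩, hk⟩, hA, hB, hL'⟩ := hL.sound i hi
    obtain ⟨a, b, hab, hca, hcb⟩ := hT₃.T_sound k (by omega) v hv hne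
    obtain ⟨e, he, rfl, rfl, rfl⟩ := halfEdge_of_lt hab hk
    refine ⟨e, he, ?_, ?_, hL'⟩
    · rw [hA, (hqker _ (hini e he) v hv).2 hca, hq₅ v hv, F₅.rt_self v hv hpv]
    · rw [hB]
      exact (hqker _ (hTlt _ hk v hv hne) _ (hter e he)).2 hcb.symm
  · intro e he
    have hhe : halfEdge n ini ter lab E (ini e) (lab e) (ter e) :=
      ⟨e, he, Or.inl ⟨rfl, rfl, rfl⟩⟩
    obtain ⟨hne, hb⟩ := hend _ _ _ hhe
    have hv := F₅.rt_lt _ (hini e he)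
    obtain ⟨i, hi, hA, hB, hL'⟩ := hL.complete (rt (ini e)) (lab e)
      ⟨⟨hv, F₅.par_rt _ (hini e he), hne⟩, hlab e he⟩
    refine ⟨i, hi, ?_, ?_, hL'⟩
    · rw [hA, hq₅ _ (hini e he)]
    · rw [hB, hq₅ _ (hTlt _ (hlab e he) _ hv hne), hq₅ _ (hter e he), hb]
  · exact hL.inj

/-! ### The final form of the time bound, and the passage from numbers back to labeled graphs -/

theorem logStar_one : logStar 1 = 0 := Nat.le_zero.1 (Nat.sInf_le (by simp))

/-- For `V ≥ 2` the iterated logarithm is at least `1`, so each added `1` costs at most a factor of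
two. For `V = 1` it vanishes and the bound is linear in `E`. -/
theorem mul_logStar_succ_le {V E : ℕ} (hV : 0 < V) :
    (V + E + 1) * (logStar V + 1) ≤ 4 * max 1 (E + (V + E) * logStar V) := by
  rcases Nat.lt_or_ge 1 V with h | h
  · have h1 := logStar_pos h
    calc (V + E + 1) * (logStar V + 1) ≤ (2 * (V + E)) * (2 * logStar V) :=
          Nat.mul_le_mul (by omega) (by omega)
      _ = 4 * ((V + E) * logStar V) := by ring
      _ ≤ _ := Nat.mul_le_mul_left _ ((Nat.le_add_left _ _).trans (le_max_right _ _))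
  · obtain rfl : V = 1 := by omega
    rw [logStar_one]
    omega

/-- The class map of a folding, on the numbers of the vertices. -/
noncomputable def Numbering.classMap {X : Type} {G H : LGraph X} (N : Numbering G) (f : G.Hom H)
    (d : H.Vert) (i : ℕ) : H.Vert :=
  if h : i < N.numV then f.vert (N.vert.symm ⟨i, h⟩) else d

theorem Numbering.classMap_vert {X : Type} {G H : LGraph X} (N : Numbering G) (f : G.Hom H)
    (d : H.Vert) (v : G.Vert) : N.classMap f d (N.vert v) = f.vert v := by
  simp [Numbering.classMap]

/-- Types below `n` express one implication of fold-closedness and types `k + n` the converse. As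
labels are less than `n`, the two kinds never share a type. -/
theorem halfClosed_iff {α : Type} {n : ℕ} {G : LGraph (Fin n)} {N : Numbering G} {m : Mem}
    (hm : m.Encodes G N) (c : ℕ → α) :
    HalfClosed (halfEdge n (m.fld 0) (m.fld 1) (m.fld 2) N.numE) c ↔
      G.FoldClosed fun v => c (N.vert v) := by
  constructor
  · intro h e e' hl
    obtain ⟨h1, h2, h3⟩ := hm.2.2 e
    obtain ⟨h1', h2', h3'⟩ := hm.2.2 e'
    beta_reduce
    rw [← h1, ← h2, ← h1', ← h2']
    rw [← hl, ← h3] at h3'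
    constructor
    · exact h _ _ _ _ _ ⟨_, (N.edge e).2, Or.inl ⟨rfl, rfl, rfl⟩⟩
        ⟨_, (N.edge e').2, Or.inl ⟨rfl, h3'.symm, rfl⟩⟩
    · exact h _ _ _ _ _ ⟨_, (N.edge e).2, Or.inr ⟨rfl, rfl, rfl⟩⟩
        ⟨_, (N.edge e').2, Or.inr ⟨rfl, by rw [h3'], rfl⟩⟩
  · rintro h a k b a' b' ⟨i, hi, hab⟩ ⟨i', hi', hab'⟩ hcc
    obtain ⟨e, he⟩ := N.edge.surjective ⟨i, hi⟩
    obtain ⟨e', he'⟩ := N.edge.surjective ⟨i', hi'⟩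
    obtain ⟨h1, h2, h3⟩ := hm.2.2 e
    obtain ⟨h1', h2', h3'⟩ := hm.2.2 e'
    rw [he] at h1 h2 h3
    rw [he'] at h1' h2' h3'
    have hlt := (G.lab e).2
    have hlt' := (G.lab e').2
    have key := h e e'
    simp only at h1 h2 h3 h1' h2' h3'
    rw [h1, h2, h3] at hab
    rw [h1', h2', h3'] at hab'
    rcases hab with ⟨rfl, rfl, rfl⟩ | ⟨rfl, rfl, rfl⟩ <;>
      rcases hab' with ⟨rfl, hk, rfl⟩ | ⟨rfl, hk, rfl⟩
    · exact (key (Fin.ext hk)).1 hcc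
    · omega
    · omega
    · exact (key (Fin.ext (by omega))).2 hcc

end Stallings

theorem theorem2 (n : ℕ) :
    ∃ (P : Stallings.Prog) (C : ℕ),
      ∀ (Δ : Stallings.LGraph (Fin n)) (N : Stallings.Numbering Δ), Δ.Connected →
        ∀ m : Stallings.Mem, m.Encodes Δ N →
          ∃ (t : ℕ) (m' : Stallings.Mem), Stallings.Exec P m t m' ∧
            t ≤ C * max 1 (N.numE + (N.numV + N.numE) * Stallings.logStar N.numV) ∧
            ∃ (Γ : Stallings.LGraph (Fin n)) (π : Δ.Hom Γ) (M : Stallings.Numbering Γ),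
              Stallings.IsFolding π ∧ Γ.Folded ∧ m'.Encodes Γ M ∧ m'.EncodesMap π N M := by
  refine ⟨Stallings.foldGraph n, Stallings.foldGraphConst n * 4, fun Δ N hΔ m hm => ?_⟩
  have : Finite Δ.Edge := Finite.of_equiv _ N.edge.symm
  obtain ⟨Γ, π, hπ, hΓ⟩ := Δ.exists_isFolding
  obtain ⟨hsv, hse⟩ := hπ.surjective
  -- This vertex shows that `N.numV` is positive, and its image is the default value of `classMap`
  -- outside the range of vertex numbers.
  obtain ⟨v₀⟩ := hΔ.1
  have hedge : ∀ i < N.numE, ∃ e, (N.edge e : ℕ) = i := fun i hi =>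
    ⟨N.edge.symm ⟨i, hi⟩, by simp⟩
  have hvert : ∀ i < N.numV, ∃ v, (N.vert v : ℕ) = i := fun i hi =>
    ⟨N.vert.symm ⟨i, hi⟩, by simp⟩
  obtain ⟨t, m', hexec, ht, hlt, hsurj, hker, hsound, hcompl, hinj⟩ :=
    Stallings.run_foldGraph (n := n) (V := N.numV) (E := N.numE)
      (c := N.classMap π (π.vert v₀)) (m := m)
      (ini := m.fld 0) (ter := m.fld 1) (lab := m.fld 2)
      (by
        intro i hi
        obtain ⟨e, rfl⟩ := hedge i hi
        rw [(hm.2.2 e).1]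
        exact (N.vert _).2)
      (by
        intro i hi
        obtain ⟨e, rfl⟩ := hedge i hi
        rw [(hm.2.2 e).2.1]
        exact (N.vert _).2)
      (by
        intro i hi
        obtain ⟨e, rfl⟩ := hedge i hi
        rw [(hm.2.2 e).2.2]
        exact (Δ.lab _).2)
      (by
        rw [Stallings.halfClosed_iff hm]
        simp only [N.classMap_vert]
        exact π.foldClosed hΓ)
      (by
        intro f hf i hi j hj hij
        rw [Stallings.halfClosed_iff hm] at hf
        obtain ⟨u, rfl⟩ := hvert i hi
        obtain ⟨v, rfl⟩ := hvert j hj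
        rw [N.classMap_vert, N.classMap_vert] at hij
        exact hπ.minimal hf hij)
      hm.1 hm.2.1 rfl rfl rfl
  refine ⟨t, m', hexec, ?_, Γ, π, ?_⟩
  · refine ht.trans ?_
    rw [mul_assoc]
    exact Nat.mul_le_mul_left _
      (Stallings.mul_logStar_succ_le (lt_of_le_of_lt (Nat.zero_le _) (N.vert v₀).2))
  obtain ⟨φ, hφ⟩ := Stallings.exists_equiv_of_kernel_eq (p := π.vert)
    (q := fun v => (⟨m'.fld 3 (N.vert v), hlt _ (N.vert v).2⟩ : Fin (m'.reg 0))) hsv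
    (by
      rintro ⟨i, hi⟩
      obtain ⟨j, hj, h⟩ := hsurj i hi
      obtain ⟨v, rfl⟩ := hvert j hj
      exact ⟨v, Fin.ext h⟩)
    (by
      intro u v
      have := hker _ (N.vert u).2 _ (N.vert v).2
      rw [N.classMap_vert, N.classMap_vert] at this
      rw [Fin.mk.injEq, this])
  have hφ' : ∀ v, (φ (π.vert v) : ℕ) = m'.fld 3 (N.vert v) := fun v => by rw [hφ]
  -- `r e` is the position in the output list of the class of the edge `e`.
  choose r hr hr0 hr1 hr2 using fun e => hcompl _ (N.edge e).2
  have hr0' : ∀ e, m'.fld 0 (r e) = φ (π.vert (Δ.ini e)) := fun e => by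
    rw [hr0, (hm.2.2 e).1, hφ']
  have hr1' : ∀ e, m'.fld 1 (r e) = φ (π.vert (Δ.ter e)) := fun e => by
    rw [hr1, (hm.2.2 e).2.1, hφ']
  have hr2' : ∀ e, m'.fld 2 (r e) = Δ.lab e := fun e => by
    rw [hr2, (hm.2.2 e).2.2]
  -- Both `r e` and `π.edge e` are determined by the label of `e` and the class of its initial
  -- vertex: the former because list entries with the same initial vertex and label coincide, the
  -- latter because `Γ` is folded.
  obtain ⟨ψ, hψ⟩ := Stallings.exists_equiv_of_kernel_eq (p := π.edge)
    (q := fun e => (⟨r e, hr e⟩ : Fin (m'.reg 1))) hse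
    (by
      rintro ⟨i, hi⟩
      obtain ⟨j, hj, h0, h1, h2⟩ := hsound i hi
      obtain ⟨e, rfl⟩ := hedge j hj
      refine ⟨e, Fin.ext (hinj _ (hr e) i hi ?_ ?_)⟩
      · rw [hr0, h0]
      · rw [hr2, h2])
    (by
      intro e e'
      rw [Fin.mk.injEq]
      constructor
      · intro h
        refine hinj _ (hr e) _ (hr e') ?_ ?_
        · rw [hr0', hr0', ← π.ini_edge, ← π.ini_edge, h]
        · rw [hr2', hr2', ← π.lab_edge, ← π.lab_edge, h]
      · intro h
        have h0 := hr0' e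
        have h2 := hr2' e
        rw [h, hr0'] at h0
        rw [h, hr2'] at h2
        refine hΓ.1 _ _ ?_ ?_
        · rw [π.lab_edge, π.lab_edge]
          exact Fin.ext h2.symm
        · rw [π.ini_edge, π.ini_edge]
          exact φ.injective (Fin.ext h0.symm))
  refine ⟨⟨m'.reg 0, m'.reg 1, φ, ψ⟩, hπ, hΓ, ⟨rfl, rfl, ?_⟩, fun v => (hφ' v).symm⟩
  intro x
  obtain ⟨e, rfl⟩ := hse x
  rw [hψ, π.ini_edge, π.ter_edge, π.lab_edge]
  exact ⟨hr0' e, hr1' e, hr2' e⟩
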